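/- Let $M$ be an $n\times n$ partial matrix: a symmetric matrix some of whose entries are unspecified (with $m_{ij}$ specified if and only if $m_{ji}$ is), whose specified entries are nonnegative reals and whose diagonal entries are specified and equal to $0$. For $d\in\mathbb N$, the pair $(M,d)$ is a yes-instance of $d$-EDMC if the unspecified entries of $M$ can be filled in so that there are (not necessarily distinct) points $p_1,\dots,p_n\in\mathbb R^d$ for which the $(i,j)$ entry of the completed matrix is $\|p_i-p_j\|_2^2$ for all $i,j$; otherwise it is a no-instance. Two instances are equivalent if both are yes-instances or both are no-instances. Theorem. There is a deterministic algorithm on the real RAM (arithmetic and comparison of real numbers and memory access take unit time, integer addition, subtraction and comparison take unit time, integer multiplication takes time linear in the bit lengths of its factors, and there is no rounding of reals to integers) whose running time is bounded by a polynomial in $n$ and which, given an instance $(M,d)$ such that every row of the $n\times n$ partial matrix $M$ has at most $\Delta$ unspecified entries, either correctly decides whether $(M,d)$ is a yes-instance, or outputs an instance $(M',d)$ equivalent to $(M,d)$ such that $M'$ is a principal $n'\times n'$ submatrix of $M$ with $n'\le (d+1)(\Delta+1)^2$. -/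

import Mathlib

/-! ### Partial matrices and the Euclidean distance matrix completion problem -/

/-- A symmetric hollow `n × n` matrix over the nonnegative reals with some unspecified entries
(`none`). The diagonal is specified and equal to `0`. -/
structure PartialMatrix (n : ℕ) where
  entry : Fin n → Fin n → Option ℝ
  nonneg : ∀ i j v, entry i j = some v → 0 ≤ v
  symm : ∀ i j, entry i j = entry j i
  diag : ∀ i, entry i i = some 0

/-- The number of unspecified entries in row `i`. -/
def PartialMatrix.unspecified {n : ℕ} (M : PartialMatrix n) (i : Fin n) : ℕ :=
  (Finset.univ.filter fun j => (M.entry i j).isNone).card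

/-- The principal submatrix of `M` on the rows and columns `f 0 < f 1 < ⋯ < f (m - 1)`. -/
def PartialMatrix.principal {m n : ℕ} (M : PartialMatrix n) (f : Fin m ↪o Fin n) :
    PartialMatrix m where
  entry i j := M.entry (f i) (f j)
  nonneg i j := M.nonneg (f i) (f j)
  symm i j := M.symm (f i) (f j)
  diag i := M.diag (f i)

/-- `D` is a Euclidean distance matrix in `ℝ^d`; the entries are squared distances, and the
points need not be distinct. -/
def IsEDM {n : ℕ} (d : ℕ) (D : Matrix (Fin n) (Fin n) ℝ) : Prop :=
  ∃ p : Fin n → EuclideanSpace ℝ (Fin d), ∀ i j, D i j = ‖p i - p j‖ ^ 2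

/-- `(M, d)` is a yes-instance of `d`-EDMC: the unspecified entries of `M` can be filled in so
that the result is a Euclidean distance matrix in `ℝ^d`. -/
def PartialMatrix.IsYes {n : ℕ} (M : PartialMatrix n) (d : ℕ) : Prop :=
  ∃ D : Matrix (Fin n) (Fin n) ℝ,
    IsEDM d D ∧ ∀ i j (v : ℝ), M.entry i j = some v → D i j = v

/-! ### The real RAM

A structured programming language over a random access memory with natural-number cells and
real cells.  A program is a fixed finite text, so that it uses finitely many registers and
finitely many (unbounded) arrays.  Array indices are computed natural numbers.  Operations cost
one unit, except that the multiplication of natural numbers is charged the bit lengths of its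
factors, so that long multiplications are not free.  Reals can be added, subtracted, multiplied,
divided and compared; they cannot be rounded, and no real constants other than (the casts of)
natural numbers can be written in a program. -/

namespace RealRAM

/-- A memory state. -/
structure State where
  natReg : ℕ → ℕ
  realReg : ℕ → ℝ
  /-- `natArr a k` is cell `k` of the natural-number array `a`. -/
  natArr : ℕ → ℕ → ℕ
  /-- `realArr a k` is cell `k` of the real array `a`. -/
  realArr : ℕ → ℕ → ℝ

/-- Expressions for natural numbers. -/
inductive NExp
  | const (k : ℕ)
  | reg (x : ℕ)
  | read (a : ℕ) (index : NExp)
  | add (e f : NExp)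
  | sub (e f : NExp)
  | mul (e f : NExp)

/-- The value of an expression; subtraction is truncated at `0`. -/
def NExp.eval (σ : State) : NExp → ℕ
  | const k => k
  | reg x => σ.natReg x
  | read a e => σ.natArr a (e.eval σ)
  | add e f => e.eval σ + f.eval σ
  | sub e f => e.eval σ - f.eval σ
  | mul e f => e.eval σ * f.eval σ

/-- The cost of evaluating an expression; `Nat.size` is the length in binary. -/
def NExp.cost (σ : State) : NExp → ℕ
  | const _ => 1
  | reg _ => 1
  | read _ e => e.cost σ + 1
  | add e f => e.cost σ + f.cost σ + 1
  | sub e f => e.cost σ + f.cost σ + 1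
  | mul e f => e.cost σ + f.cost σ + (e.eval σ).size + (f.eval σ).size + 1

/-- Expressions for real numbers. -/
inductive RExp
  | cast (e : NExp)
  | reg (x : ℕ)
  | read (a : ℕ) (index : NExp)
  | add (u v : RExp)
  | sub (u v : RExp)
  | mul (u v : RExp)
  | div (u v : RExp)

/-- The value of an expression; division by `0` returns `0`. -/
noncomputable def RExp.eval (σ : State) : RExp → ℝ
  | cast e => (e.eval σ : ℝ)
  | reg x => σ.realReg x
  | read a e => σ.realArr a (e.eval σ)
  | add u v => u.eval σ + v.eval σ
  | sub u v => u.eval σ - v.eval σ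
  | mul u v => u.eval σ * v.eval σ
  | div u v => u.eval σ / v.eval σ

/-- The cost of evaluating an expression. -/
def RExp.cost (σ : State) : RExp → ℕ
  | cast e => e.cost σ + 1
  | reg _ => 1
  | read _ e => e.cost σ + 1
  | add u v => u.cost σ + v.cost σ + 1
  | sub u v => u.cost σ + v.cost σ + 1
  | mul u v => u.cost σ + v.cost σ + 1
  | div u v => u.cost σ + v.cost σ + 1

/-- Branching conditions. -/
inductive Test
  | natLe (e f : NExp)
  | realLe (u v : RExp)
  | not (b : Test)
  | and (b c : Test)

def Test.Holds (σ : State) : Test → Prop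
  | natLe e f => e.eval σ ≤ f.eval σ
  | realLe u v => u.eval σ ≤ v.eval σ
  | not b => ¬ b.Holds σ
  | and b c => b.Holds σ ∧ c.Holds σ

def Test.cost (σ : State) : Test → ℕ
  | natLe e f => e.cost σ + f.cost σ + 1
  | realLe u v => u.cost σ + v.cost σ + 1
  | not b => b.cost σ + 1
  | and b c => b.cost σ + c.cost σ + 1

/-- Programs. -/
inductive Prog
  | skip
  | setNat (x : ℕ) (e : NExp)
  | setReal (x : ℕ) (u : RExp)
  | writeNat (a : ℕ) (index e : NExp)
  | writeReal (a : ℕ) (index : NExp) (u : RExp)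
  | seq (P Q : Prog)
  | ite (b : Test) (P Q : Prog)
  | while (b : Test) (P : Prog)

def State.setNat (σ : State) (x v : ℕ) : State :=
  { σ with natReg := Function.update σ.natReg x v }

noncomputable def State.setReal (σ : State) (x : ℕ) (v : ℝ) : State :=
  { σ with realReg := Function.update σ.realReg x v }

def State.writeNat (σ : State) (a k v : ℕ) : State :=
  { σ with natArr := Function.update σ.natArr a (Function.update (σ.natArr a) k v) }

noncomputable def State.writeReal (σ : State) (a k : ℕ) (v : ℝ) : State :=
  { σ with realArr := Function.update σ.realArr a (Function.update (σ.realArr a) k v) }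

/-- `Exec P σ t τ`: started in the state `σ`, the program `P` halts after exactly `t` time units
in the state `τ`. -/
inductive Exec : Prog → State → ℕ → State → Prop
  | skip (σ : State) : Exec .skip σ 1 σ
  | setNat (σ : State) (x : ℕ) (e : NExp) :
      Exec (.setNat x e) σ (e.cost σ + 1) (σ.setNat x (e.eval σ))
  | setReal (σ : State) (x : ℕ) (u : RExp) :
      Exec (.setReal x u) σ (u.cost σ + 1) (σ.setReal x (u.eval σ))
  | writeNat (σ : State) (a : ℕ) (k e : NExp) :
      Exec (.writeNat a k e) σ (k.cost σ + e.cost σ + 1) (σ.writeNat a (k.eval σ) (e.eval σ))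
  | writeReal (σ : State) (a : ℕ) (k : NExp) (u : RExp) :
      Exec (.writeReal a k u) σ (k.cost σ + u.cost σ + 1) (σ.writeReal a (k.eval σ) (u.eval σ))
  | seq {P Q : Prog} {σ τ υ : State} {s t : ℕ} :
      Exec P σ s τ → Exec Q τ t υ → Exec (.seq P Q) σ (s + t) υ
  | iteTrue {b : Test} {P Q : Prog} {σ τ : State} {t : ℕ} :
      b.Holds σ → Exec P σ t τ → Exec (.ite b P Q) σ (b.cost σ + t + 1) τ
  | iteFalse {b : Test} {P Q : Prog} {σ τ : State} {t : ℕ} :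
      ¬ b.Holds σ → Exec Q σ t τ → Exec (.ite b P Q) σ (b.cost σ + t + 1) τ
  | whileTrue {b : Test} {P : Prog} {σ τ υ : State} {s t : ℕ} :
      b.Holds σ → Exec P σ s τ → Exec (.while b P) τ t υ →
        Exec (.while b P) σ (b.cost σ + s + t + 1) υ
  | whileFalse {b : Test} {P : Prog} {σ : State} :
      ¬ b.Holds σ → Exec (.while b P) σ (b.cost σ + 1) σ

/-- The instance `(M, d)` is stored in block `b` of the memory: the size `n` and the dimension
`d` in two registers, and, in row-major order, the pattern of specified entries (`1` for
specified, `0` for unspecified) in the natural-number array `b` and the values of the specified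
entries in the real array `b`. Nothing is required of any other part of the memory. -/
def State.Stores (σ : State) (b : ℕ) {n : ℕ} (M : PartialMatrix n) (d : ℕ) : Prop :=
  σ.natReg (2 * b) = n ∧ σ.natReg (2 * b + 1) = d ∧
    ∀ i j : Fin n,
      σ.natArr b (i * n + j) = (if (M.entry i j).isSome then 1 else 0) ∧
      ∀ v : ℝ, M.entry i j = some v → σ.realArr b (i * n + j) = v

/-- The register in which a program leaves its verdict: `0` for "no", `1` for "yes", and `2` for
"see the output instance". -/
def verdict (σ : State) : ℕ := σ.natReg 4

end RealRAM

/-! Let K be one more than the largest number of unspecified entries in a row, so that K ≤ Δ + 1.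
The elements are scanned in order and distributed greedily over K bases. An element with an
unspecified entry against an earlier basis element is set aside (label 0) but kept. Any other
element joins the first basis on which it does not look affinely dependent; if it looks dependent on
all K bases, it is marked for deletion (label K + 1). By construction all entries between basis
elements are specified.

Dependence is decided by Gaussian elimination on the doubled Gram matrix 2⟨x - b, y - b⟩ = D x b + D
b y - D x y. `exists_weights` shows, without assuming any realization, that the residual of x comes
from subtracting an affine combination of the pivots. Only vanishing of residuals is tested, never
their sign: an unrealizable basis may survive, but it is then kept in the output, which is a
no-instance too.

Refutation (`Labelling.not_realizes`): in a realization the residual (x, x) is 2‖r‖², where r is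
orthogonal to the span of the pivots. Hence a basis in ℝ^d has at most d + 1 elements, and if the
residual (x, x) vanishes, so does every residual (x, y) that is computable from specified entries. A
violation of either is a certificate for "no".

Deletion (`Labelling.exists_realizes`): if no test fails, a realization of the kept elements extends
to a deleted x. Each basis proposes a point for x, the affine combination of its members with the
elimination weights. This point has the right distance to every y that is joined to x and to that
basis, in particular to all basis elements; as a point with the right distances to a single basis is
unique, all K proposals coincide. Any y has fewer than K unspecified entries, so one of the K
disjoint bases is fully joined to y and certifies its distance to x.

Size (`Labelling.card_le`): there are at most (d + 1)K basis elements, and every element set aside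
is one of at most K - 1 unspecified partners of a basis element.

The rest is a Hoare-style verification of a program. Register 5 holds K, 6 the current element, 7
the current label minus one, 13 the failure flag, 15 whether the element has been placed; natural
array 2 holds the labels, real array 2 the residuals. -/

namespace EDMC

open Finset

/-! ### Residual Gram matrices of squared distances -/

/-- For a list of pivots, the most recent one first, twice the Gram matrix of the components
orthogonal to the affine span of the pivots, computed from the squared distances `D` by Gaussian
elimination. -/
noncomputable def residual (D : ℕ → ℕ → ℝ) : List ℕ → ℕ → ℕ → ℝ
  | [], _, _ => 0
  | [b], x, y => D x b + D b y - D x y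
  | b :: c :: bs, x, y =>
    residual D (c :: bs) x y -
      residual D (c :: bs) x b * residual D (c :: bs) b y / residual D (c :: bs) b b

/-- Every pivot but the first one has a nonzero residual with respect to the earlier ones. -/
def PivotsNonzero (D : ℕ → ℕ → ℝ) : List ℕ → Prop
  | [] => True
  | [_] => True
  | b :: c :: bs => residual D (c :: bs) b b ≠ 0 ∧ PivotsNonzero D (c :: bs)

/-- The residual of `x` is `x` minus an affine combination of the pivots. -/
theorem exists_weights {D : ℕ → ℕ → ℝ} {n : ℕ} : ∀ {bs : List ℕ}, bs ≠ [] → PivotsNonzero D bs →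
    (∀ b ∈ bs, b < n) → (∀ b ∈ bs, D b b = 0) → ∀ x, ∃ w : ℕ → ℝ,
      (∀ c, c ∉ bs → w c = 0) ∧ ∑ c ∈ range n, w c = 1 ∧
      ∀ y, ∀ b ∈ bs, residual D bs x y =
        (D x b - ∑ c ∈ range n, w c * D c b) - (D x y - ∑ c ∈ range n, w c * D c y)
  | [], h, _, _, _, _ => absurd rfl h
  | [b], _, _, hlt, hd, x => by
    have hb : b ∈ range n := mem_range.2 (hlt b (by simp))
    refine ⟨Pi.single b 1, fun c hc => ?_, ?_, fun y a ha => ?_⟩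
    · rw [Pi.single_apply, if_neg (by simpa using hc)]
    · simp [Pi.single_apply, hb, -mem_range]
    · obtain rfl : a = b := by simpa using ha
      have h0 := hd a (by simp)
      simp only [residual, Pi.single_apply, ite_mul, one_mul, zero_mul, sum_ite_eq', hb, if_true, h0]
      ring
  | b :: c :: bs, _, hp, hlt, hd, x => by
    have ih := exists_weights (bs := c :: bs) (by simp) hp.2
      (fun b hb => hlt b (List.mem_cons_of_mem _ hb))
      (fun b hb => hd b (List.mem_cons_of_mem _ hb))
    obtain ⟨w, hw0, hw1, hw⟩ := ih x
    obtain ⟨u, hu0, hu1, hu⟩ := ih b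
    have hb : b ∈ range n := mem_range.2 (hlt b (by simp))
    set R := residual D (c :: bs) with hR
    -- The elimination multiplier. The new weights are w + t(δ_b - u): the correction has total
    -- weight 0, so the sum stays 1.
    set t := R x b / R b b with ht
    have hbb : R b b ≠ 0 := hp.1
    have key : ∀ y, ∑ e ∈ range n, (w e + t * ((Pi.single b 1 : ℕ → ℝ) e - u e)) * D e y
        = ∑ e ∈ range n, w e * D e y + t * (D b y - ∑ e ∈ range n, u e * D e y) := fun y => by
      have h1 : ∑ e ∈ range n, (Pi.single b 1 : ℕ → ℝ) e * D e y = D b y := by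
        simp [Pi.single_apply, hb, -mem_range]
      rw [← h1, ← sum_sub_distrib, mul_sum, ← sum_add_distrib]
      exact sum_congr rfl fun e _ => by ring
    have hstep : ∀ y, ∀ a ∈ c :: bs, residual D (b :: c :: bs) x y =
        (D x a - ∑ e ∈ range n, (w e + t * ((Pi.single b 1 : ℕ → ℝ) e - u e)) * D e a) -
        (D x y - ∑ e ∈ range n, (w e + t * ((Pi.single b 1 : ℕ → ℝ) e - u e)) * D e y) := by
      intro y a ha
      have e1 : residual D (b :: c :: bs) x y = R x y - t * R b y := by
        simp only [residual, ← hR, ht]; ring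
      rw [e1, key, key, hw y a ha, hu y a ha]
      ring
    refine ⟨fun e => w e + t * ((Pi.single b 1 : ℕ → ℝ) e - u e), fun e he => ?_, ?_,
      fun y a ha => ?_⟩
    · have h1 : e ≠ b := fun h => he (by simp [h])
      have h2 : e ∉ c :: bs := fun h => he (List.mem_cons_of_mem _ h)
      simp [h1, hw0 e h2, hu0 e h2]
    · rw [sum_add_distrib, hw1, ← mul_sum, sum_sub_distrib, hu1]
      simp [Pi.single_apply, hb, -mem_range]
    -- For the new pivot as reference point: the new residual of x against it is 0, so it gives the
    -- same value as the old reference point c.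
    · rcases List.mem_cons.1 ha with rfl | ha
      · have h1 := hstep y c (by simp)
        have h2 := hstep a c (by simp)
        have h3 : residual D (a :: c :: bs) x a = 0 := by
          simp only [residual, ← hR]; field_simp; ring
        rw [h3] at h2
        linarith
      · exact hstep y a ha

/-! ### Residuals in a Euclidean realization -/

section Geometry

variable {V : Type*} [NormedAddCommGroup V] [InnerProductSpace ℝ V]

/-- Leibniz's identity for the distance to a barycentre. With q as origin, both sides are expanded
into inner products; the double sum of squared distances recovers the Gram double sum because the
weights add up to 1. -/
theorem norm_sq_affineCombination_sub {s : Finset ℕ} {w : ℕ → ℝ} (hw : ∑ c ∈ s, w c = 1)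
    (p : ℕ → V) (q : V) :
    ‖∑ c ∈ s, w c • p c - q‖ ^ 2 = ∑ c ∈ s, w c * ‖p c - q‖ ^ 2 -
      (∑ c ∈ s, w c * ∑ e ∈ s, w e * ‖p c - p e‖ ^ 2) / 2 := by
  have h1 : ∑ c ∈ s, w c • p c - q = ∑ c ∈ s, w c • (p c - q) := by
    simp only [smul_sub, sum_sub_distrib, ← sum_smul, hw, one_smul]
  have h2 : ∀ c e, ‖p c - p e‖ ^ 2 =
      ‖p c - q‖ ^ 2 - 2 * inner ℝ (p c - q) (p e - q) + ‖p e - q‖ ^ 2 := fun c e => by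
    rw [← norm_sub_sq_real]; congr 2; abel
  have h3 : ‖∑ c ∈ s, w c • (p c - q)‖ ^ 2 =
      ∑ c ∈ s, w c * ∑ e ∈ s, w e * inner ℝ (p c - q) (p e - q) := by
    rw [← real_inner_self_eq_norm_sq, sum_inner]
    refine sum_congr rfl fun c _ => ?_
    rw [inner_sum, mul_sum]
    refine sum_congr rfl fun e _ => ?_
    rw [real_inner_smul_left, real_inner_smul_right]
  have h4 : ∀ c, ∑ e ∈ s, w e * ‖p c - p e‖ ^ 2 = ‖p c - q‖ ^ 2 -
      2 * (∑ e ∈ s, w e * inner ℝ (p c - q) (p e - q)) + ∑ e ∈ s, w e * ‖p e - q‖ ^ 2 := fun c => by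
    have : ‖p c - q‖ ^ 2 = ∑ e ∈ s, w e * ‖p c - q‖ ^ 2 := by rw [← sum_mul, hw, one_mul]
    rw [this, mul_sum, ← sum_sub_distrib, ← sum_add_distrib]
    exact sum_congr rfl fun e _ => by rw [h2]; ring
  have h5 : ∑ c ∈ s, w c * ∑ e ∈ s, w e * ‖p c - p e‖ ^ 2 = 2 * ∑ c ∈ s, w c * ‖p c - q‖ ^ 2 -
      2 * ∑ c ∈ s, w c * ∑ e ∈ s, w e * inner ℝ (p c - q) (p e - q) := by
    simp_rw [h4, mul_add, mul_sub, sum_add_distrib, sum_sub_distrib, ← sum_mul, hw,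
      mul_left_comm _ (2 : ℝ), ← mul_sum]
    ring
  rw [h1, h3, h5]
  ring

theorem sum_congr_weights {s : Finset ℕ} {w : ℕ → ℝ} {bs : List ℕ} (hw : ∀ c, c ∉ bs → w c = 0)
    {f g : ℕ → ℝ} (h : ∀ c ∈ bs, f c = g c) : ∑ c ∈ s, w c * f c = ∑ c ∈ s, w c * g c :=
  sum_congr rfl fun c _ => by
    by_cases hc : c ∈ bs
    · rw [h c hc]
    · rw [hw c hc, zero_mul, zero_mul]

/-- The points `p` realize the specified distances between the elements of `S`. -/
def Realizes (E : ℕ → ℕ → Prop) (D : ℕ → ℕ → ℝ) (S : Set ℕ) (p : ℕ → V) : Prop :=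
  ∀ i ∈ S, ∀ j ∈ S, E i j → D i j = ‖p i - p j‖ ^ 2

/-- In a realization, the residuals of specified distances are inner products. -/
theorem Realizes.exists_residual {E : ℕ → ℕ → Prop} {D : ℕ → ℕ → ℝ} {n : ℕ} {p : ℕ → V}
    (hp : Realizes E D {i | i < n} p) (hEs : ∀ i < n, ∀ j < n, E i j → E j i)
    (hE0 : ∀ i < n, E i i) (hD0 : ∀ i < n, D i i = 0)
    {bs : List ℕ} (hbs : bs ≠ []) (hpiv : PivotsNonzero D bs) (hlt : ∀ b ∈ bs, b < n)
    (hcl : ∀ b ∈ bs, ∀ c ∈ bs, E b c) {x : ℕ} (hx : x < n) (hxb : ∀ b ∈ bs, E b x) :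
    ∃ r : V, (∀ b ∈ bs, ∀ c ∈ bs, inner ℝ r (p c - p b) = 0) ∧
      (∀ b ∈ bs, 2 * inner ℝ r (p x - p b) = residual D bs x x) ∧
      residual D bs x x = 2 * ‖r‖ ^ 2 ∧
      ∀ y < n, E x y → (∀ b ∈ bs, E b y) → ∀ b ∈ bs,
        residual D bs x y = 2 * inner ℝ r (p y - p b) := by
  obtain ⟨w, hw0, hw1, hw⟩ := exists_weights hbs hpiv hlt (fun b hb => hD0 b (hlt b hb)) x
  set r : V := p x - ∑ c ∈ range n, w c • p c with hr
  have hmain : ∀ y < n, E x y → (∀ b ∈ bs, E b y) → ∀ b ∈ bs,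
      residual D bs x y = 2 * inner ℝ r (p y - p b) := by
    intro y hy hxy hby b hb
    have hbn := hlt b hb
    rw [hw y b hb, hp x hx b hbn (hEs b hbn x hx (hxb b hb)), hp x hx y hy hxy,
      sum_congr_weights hw0 (fun c hc => hp c (hlt c hc) b hbn (hcl c hc b hb)),
      sum_congr_weights hw0 (fun c hc => hp c (hlt c hc) y hy (hby c hc))]
    -- The term ‖z‖² cancels, so the difference is affine in z and commutes with combinations of
    -- total weight 1.
    have e1 : ∀ z : V, ‖z - p b‖ ^ 2 - ‖z - p y‖ ^ 2 =
        2 * inner ℝ z (p y - p b) + (‖p b‖ ^ 2 - ‖p y‖ ^ 2) := fun z => by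
      rw [norm_sub_sq_real, norm_sub_sq_real, inner_sub_right]; ring
    have e2 : ∑ c ∈ range n, w c * ‖p c - p b‖ ^ 2 - ∑ c ∈ range n, w c * ‖p c - p y‖ ^ 2 =
        2 * inner ℝ (∑ c ∈ range n, w c • p c) (p y - p b) + (‖p b‖ ^ 2 - ‖p y‖ ^ 2) := by
      rw [← one_mul (‖p b‖ ^ 2 - ‖p y‖ ^ 2), ← hw1, sum_mul, sum_inner, mul_sum,
        ← sum_sub_distrib, ← sum_add_distrib]
      refine sum_congr rfl fun c _ => ?_
      rw [← mul_sub, e1, real_inner_smul_left]; ring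
    have e3 := e1 (p x)
    rw [hr, inner_sub_left]
    linarith
  -- The residual (x, c) may be computed with reference point b or c; the second choice gives 0.
  have horth : ∀ b ∈ bs, ∀ c ∈ bs, inner ℝ r (p c - p b) = 0 := by
    intro b hb c hc
    have h1 := hmain c (hlt c hc) (hEs c (hlt c hc) x hx (hxb c hc)) (fun e he => hcl e he c hc)
    have h2 := h1 b hb
    have h3 := h1 c hc
    simp only [sub_self, inner_zero_right] at h3
    linarith
  have hxx : ∀ b ∈ bs, 2 * inner ℝ r (p x - p b) = residual D bs x x := fun b hb =>
    (hmain x hx (hE0 x hx) hxb b hb).symm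
  refine ⟨r, horth, hxx, ?_, hmain⟩
  obtain ⟨b, hb⟩ := List.exists_mem_of_ne_nil bs hbs
  have e : p x - p b = r + ∑ c ∈ range n, w c • (p c - p b) := by
    simp only [smul_sub, sum_sub_distrib, ← sum_smul, hw1, one_smul, hr]; abel
  rw [← hxx b hb, e, inner_add_right, real_inner_self_eq_norm_sq, inner_sum,
    sum_eq_zero (fun c _ => ?_), add_zero]
  by_cases hc : c ∈ bs
  · rw [real_inner_smul_right, horth b hb c hc, mul_zero]
  · rw [hw0 c hc, zero_smul, inner_zero_right]

/-- Each further pivot enlarges the span of differences: its residual vector is orthogonal to the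
old span, but not to the difference between the new pivot and an old one. -/
theorem Realizes.length_le [FiniteDimensional ℝ V] {E : ℕ → ℕ → Prop} {D : ℕ → ℕ → ℝ} {n : ℕ}
    {p : ℕ → V}
    (hp : Realizes E D {i | i < n} p) (hEs : ∀ i < n, ∀ j < n, E i j → E j i)
    (hE0 : ∀ i < n, E i i) (hD0 : ∀ i < n, D i i = 0) :
    ∀ {bs : List ℕ}, PivotsNonzero D bs → (∀ b ∈ bs, b < n) → (∀ b ∈ bs, ∀ c ∈ bs, E b c) →
      bs.length ≤ Module.finrank ℝ (vectorSpan ℝ (p '' {b | b ∈ bs})) + 1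
  | [], _, _, _ => by simp
  | [b], _, _, _ => by simp
  | b :: c :: bs, hpiv, hlt, hcl => by
    have hlt' : ∀ e ∈ c :: bs, e < n := fun e he => hlt e (List.mem_cons_of_mem _ he)
    have hcl' : ∀ e ∈ c :: bs, ∀ f ∈ c :: bs, E e f := fun e he f hf =>
      hcl e (List.mem_cons_of_mem _ he) f (List.mem_cons_of_mem _ hf)
    have ih := hp.length_le hEs hE0 hD0 hpiv.2 hlt' hcl'
    obtain ⟨r, horth, hxx, -, -⟩ := hp.exists_residual hEs hE0 hD0 (List.cons_ne_nil c bs) hpiv.2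
      hlt' hcl' (hlt b (by simp)) (fun e he => hcl e (List.mem_cons_of_mem _ he) b (by simp))
    have hle : vectorSpan ℝ (p '' {e | e ∈ c :: bs}) ≤ vectorSpan ℝ (p '' {e | e ∈ b :: c :: bs}) :=
      vectorSpan_mono ℝ (Set.image_mono fun e he => List.mem_cons_of_mem _ he)
    have hin : p b - p c ∈ vectorSpan ℝ (p '' {e | e ∈ b :: c :: bs}) :=
      vsub_mem_vectorSpan ℝ ⟨b, by simp, rfl⟩ ⟨c, by simp, rfl⟩
    have hnot : p b - p c ∉ vectorSpan ℝ (p '' {e | e ∈ c :: bs}) := by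
      intro h
      have hsub : vectorSpan ℝ (p '' {e | e ∈ c :: bs}) ≤ (ℝ ∙ r)ᗮ := by
        rw [vectorSpan_def, Submodule.span_le]
        rintro _ ⟨_, ⟨e, he, rfl⟩, _, ⟨f, hf, rfl⟩, rfl⟩
        exact Submodule.mem_orthogonal_singleton_iff_inner_right.2 (horth f hf e he)
      have h0 := Submodule.mem_orthogonal_singleton_iff_inner_right.1 (hsub h)
      have h1 := hxx c (by simp)
      rw [h0, mul_zero] at h1
      exact hpiv.1 h1.symm
    have := Submodule.finrank_lt_finrank_of_lt (lt_of_le_of_ne hle fun h => hnot (h ▸ hin))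
    simp only [List.length_cons] at ih ⊢
    omega

end Geometry

end EDMC

namespace EDMC

open Finset

/-! ### Placing a dependent point -/

section Geometry

variable {V : Type*} [NormedAddCommGroup V] [InnerProductSpace ℝ V]

/-- A point whose residual vanishes formally can be placed in any realization of the pivots. -/
theorem Realizes.exists_point {E : ℕ → ℕ → Prop} {D : ℕ → ℕ → ℝ} {n : ℕ} {S : Set ℕ} {p : ℕ → V}
    (hp : Realizes E D S p) (hD0 : ∀ i < n, D i i = 0)
    {bs : List ℕ} (hbs : bs ≠ []) (hpiv : PivotsNonzero D bs) (hlt : ∀ b ∈ bs, b < n)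
    (hS : ∀ b ∈ bs, b ∈ S) (hcl : ∀ b ∈ bs, ∀ c ∈ bs, E b c) {x : ℕ} (hx : x < n)
    (hsymm : ∀ b ∈ bs, D x b = D b x) (hxx : residual D bs x x = 0) :
    ∃ z : V, (∀ v ∈ S, residual D bs x v = 0 → (∀ b ∈ bs, E b v) → D x v = ‖z - p v‖ ^ 2) ∧
      ∀ z' : V, (∀ b ∈ bs, ‖p b - z'‖ ^ 2 = D b x) → z = z' := by
  obtain ⟨w, hw0, hw1, hw⟩ := exists_weights hbs hpiv hlt (fun b hb => hD0 b (hlt b hb)) x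
  -- Vanishing of the residual (x, x) makes κ the constant by which D b x exceeds the weighted sum
  -- over the pivots, for every pivot b. Averaging over b shows that the double sum in Leibniz's
  -- identity is -2κ.
  set κ : ℝ := -∑ c ∈ range n, w c * D c x with hκ
  have hb : ∀ b ∈ bs, D b x = ∑ c ∈ range n, w c * D c b + κ := fun b hb => by
    have := hw x b hb
    rw [hxx, hD0 x hx, hsymm b hb] at this
    linarith
  have h1 : ∑ c ∈ range n, w c * D c x =
      (∑ c ∈ range n, w c * ∑ e ∈ range n, w e * D e c) + κ := by
    rw [sum_congr_weights hw0 hb]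
    simp_rw [mul_add, sum_add_distrib, ← sum_mul, hw1, one_mul]
  have h2 : ∑ c ∈ range n, w c * ∑ e ∈ range n, w e * ‖p c - p e‖ ^ 2 =
      ∑ c ∈ range n, w c * ∑ e ∈ range n, w e * D e c :=
    sum_congr_weights hw0 fun c hc => sum_congr_weights hw0 fun e he => by
      rw [norm_sub_rev, hp e (hS e he) c (hS c hc) (hcl e he c hc)]
  have h3 : ∀ q : V, ‖∑ c ∈ range n, w c • p c - q‖ ^ 2 =
      ∑ c ∈ range n, w c * ‖p c - q‖ ^ 2 + κ := fun q => by
    rw [norm_sq_affineCombination_sub hw1, h2]; linarith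
  refine ⟨∑ c ∈ range n, w c • p c, fun v hv hv0 hbv => ?_, fun z' hz' => ?_⟩
  · rw [h3, ← sum_congr_weights hw0 fun c hc => hp c (hS c hc) v hv (hbv c hc)]
    obtain ⟨b, hb'⟩ := List.exists_mem_of_ne_nil bs hbs
    have e1 := hw v b hb'
    have e2 := hb b hb'
    rw [hv0, hsymm b hb'] at e1
    linarith
  -- At q = z' the weighted sum equals -κ by the definition of κ, so the squared distance from z is
  -- 0.
  · have := h3 z'
    rw [sum_congr_weights hw0 hz', hκ, add_neg_cancel] at this
    exact sub_eq_zero.1 (norm_eq_zero.1 (pow_eq_zero_iff two_ne_zero |>.1 this))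

end Geometry

/-! ### Labellings -/

/-- The elements below `v` with label `c`, in decreasing order. -/
def pivots (lab : ℕ → ℕ) (c : ℕ) : ℕ → List ℕ
  | 0 => []
  | v + 1 => if lab v = c then v :: pivots lab c v else pivots lab c v

theorem mem_pivots {lab : ℕ → ℕ} {c u : ℕ} : ∀ {v}, u ∈ pivots lab c v ↔ u < v ∧ lab u = c
  | 0 => by simp [pivots]
  | v + 1 => by
    have ih := mem_pivots (lab := lab) (c := c) (u := u) (v := v)
    unfold pivots
    split_ifs with h
    · rw [List.mem_cons, ih, Nat.lt_succ_iff_lt_or_eq]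
      constructor
      · rintro (rfl | h') <;> tauto
      · rintro ⟨h1 | h1, h2⟩ <;> tauto
    · rw [ih, Nat.lt_succ_iff_lt_or_eq]
      constructor
      · tauto
      · rintro ⟨h1 | rfl, h2⟩ <;> tauto

theorem pivots_congr {lab lab' : ℕ → ℕ} {c : ℕ} : ∀ {v}, (∀ u < v, lab u = lab' u) →
    pivots lab c v = pivots lab' c v
  | 0, _ => rfl
  | v + 1, h => by
    unfold pivots
    rw [h v (Nat.lt_succ_self v), pivots_congr fun u hu => h u (Nat.lt_succ_of_lt hu)]

theorem length_pivots (lab : ℕ → ℕ) (c : ℕ) : ∀ v,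
    (pivots lab c v).length = #{u ∈ range v | lab u = c}
  | 0 => by simp [pivots]
  | v + 1 => by
    unfold pivots
    rw [range_add_one, filter_insert]
    split_ifs with h
    · rw [card_insert_of_notMem (by simp), List.length_cons, length_pivots lab c v]
    · exact length_pivots lab c v

/-- `u` belongs to one of the `K` bases. -/
def Assigned (K : ℕ) (lab : ℕ → ℕ) (u : ℕ) : Prop := 1 ≤ lab u ∧ lab u ≤ K

/-- All entries between `w` and the earlier elements of the bases are specified. -/
def Joined (E : ℕ → ℕ → Prop) (K : ℕ) (lab : ℕ → ℕ) (w : ℕ) : Prop :=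
  ∀ u < w, Assigned K lab u → E u w

/-- The elements below `v` are distributed over `K` bases (labels `1, …, K`), elements that are
dependent on all bases (label `K + 1`), and elements that have an unspecified entry with a member
of a basis (label `0`). -/
structure Labelling (E : ℕ → ℕ → Prop) (D : ℕ → ℕ → ℝ) (K : ℕ) (lab : ℕ → ℕ) (v : ℕ) : Prop where
  le : ∀ w < v, lab w ≤ K + 1
  other : ∀ w < v, lab w = 0 → ∃ u < w, Assigned K lab u ∧ ¬ E u w
  joined : ∀ w < v, lab w ≠ 0 → Joined E K lab w
  indep : ∀ w < v, Assigned K lab w →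
    pivots lab (lab w) w = [] ∨ residual D (pivots lab (lab w) w) w w ≠ 0
  dep : ∀ w < v, lab w = K + 1 → ∀ c, 1 ≤ c → c ≤ K →
    pivots lab c w ≠ [] ∧ residual D (pivots lab c w) w w = 0

/-- The element `w` has an entry that contradicts its dependence on the basis `c`. -/
def Conflict (E : ℕ → ℕ → Prop) (D : ℕ → ℕ → ℝ) (n : ℕ) (lab : ℕ → ℕ) (c w : ℕ) : Prop :=
  ∃ y < n, E w y ∧ (∀ u ∈ pivots lab c w, E u y) ∧ residual D (pivots lab c w) w y ≠ 0

/-- No basis is too large, and no dependence is contradicted. -/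
structure Passed (E : ℕ → ℕ → Prop) (D : ℕ → ℕ → ℝ) (n d K : ℕ) (lab : ℕ → ℕ) (v : ℕ) :
    Prop where
  short : ∀ w < v, Assigned K lab w → (pivots lab (lab w) w).length ≤ d
  checked : ∀ w < v, lab w = K + 1 → ∀ c, 1 ≤ c → c ≤ K → ¬ Conflict E D n lab c w

/-- Some basis is too large, or some dependence is contradicted. -/
def Failed (E : ℕ → ℕ → Prop) (D : ℕ → ℕ → ℝ) (n d K : ℕ) (lab : ℕ → ℕ) (v : ℕ) : Prop :=
  ∃ w < v, Joined E K lab w ∧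
    ((Assigned K lab w ∧ d < (pivots lab (lab w) w).length) ∨
      ∃ c, 1 ≤ c ∧ c ≤ K ∧ pivots lab c w ≠ [] ∧ residual D (pivots lab c w) w w = 0 ∧
        Conflict E D n lab c w)

/-! ### Soundness of refutation and deletion, and the size bound -/

section

variable {E : ℕ → ℕ → Prop} {D : ℕ → ℕ → ℝ} {n d K : ℕ} {lab : ℕ → ℕ}

/-- The independence recorded when an element was labelled refers to exactly the members of its
basis below it, that is, to the tail of the list at that point. -/
theorem Labelling.pivotsNonzero {v : ℕ} (h : Labelling E D K lab v) {c : ℕ} (hc1 : 1 ≤ c)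
    (hcK : c ≤ K) : ∀ {w}, w ≤ v → PivotsNonzero D (pivots lab c w)
  | 0, _ => trivial
  | w + 1, hw => by
    have ih := h.pivotsNonzero hc1 hcK (w := w) (by omega)
    unfold pivots
    split_ifs with hl
    · have := h.indep w hw ⟨by omega, by omega⟩
      rw [hl] at this
      cases hp : pivots lab c w with
      | nil => trivial
      | cons b bs =>
        rw [hp] at ih this
        exact ⟨this.resolve_left (by simp), ih⟩
    · exact ih

/-- The later of the two was admitted only because it was joined to all earlier basis elements, of
whichever basis. -/
theorem Labelling.assigned_clique {v : ℕ} (h : Labelling E D K lab v) (hvn : v ≤ n)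
    (hEs : ∀ i < n, ∀ j < n, E i j → E j i) (hE0 : ∀ i < n, E i i) {a b : ℕ} (ha : a < v)
    (hb : b < v) (ha' : Assigned K lab a) (hb' : Assigned K lab b) : E a b := by
  rcases lt_trichotomy a b with hab | rfl | hab
  · exact h.joined b hb (by have := hb'.1; omega) a hab ha'
  · exact hE0 a (by omega)
  · exact hEs b (by omega) a (by omega) (h.joined a ha (by have := ha'.1; omega) b hab hb')

theorem assigned_of_mem_pivots {c w u : ℕ} (hc1 : 1 ≤ c) (hcK : c ≤ K)
    (hu : u ∈ pivots lab c w) : u < w ∧ Assigned K lab u := by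
  obtain ⟨h1, h2⟩ := mem_pivots.1 hu
  exact ⟨h1, by omega, by omega⟩

/-- A failed test refutes realizability. -/
theorem Labelling.not_realizes (h : Labelling E D K lab n) (hf : Failed E D n d K lab n)
    (hEs : ∀ i < n, ∀ j < n, E i j → E j i) (hE0 : ∀ i < n, E i i) (hD0 : ∀ i < n, D i i = 0)
    (p : ℕ → EuclideanSpace ℝ (Fin d)) : ¬ Realizes E D {i | i < n} p := by
  intro hp
  obtain ⟨w, hw, hj, ⟨ha, hlen⟩ | ⟨c, hc1, hcK, hne, hz, y, hy, hwy, huy, hres⟩⟩ := hf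
  -- Going up to w + 1 includes w itself, so the clique has at least d + 2 elements, one more than
  -- ℝ^d allows.
  · have hpiv : PivotsNonzero D (pivots lab (lab w) (w + 1)) :=
      h.pivotsNonzero ha.1 ha.2 hw
    have hmem : ∀ b ∈ pivots lab (lab w) (w + 1), b < n ∧ Assigned K lab b := fun b hb => by
      have := assigned_of_mem_pivots ha.1 ha.2 hb
      exact ⟨by omega, this.2⟩
    have h1 := hp.length_le hEs hE0 hD0 hpiv (fun b hb => (hmem b hb).1) (fun b hb e he =>
      h.assigned_clique le_rfl hEs hE0 (hmem b hb).1 (hmem e he).1 (hmem b hb).2 (hmem e he).2)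
    have h2 := Submodule.finrank_le (vectorSpan ℝ (p '' {b | b ∈ pivots lab (lab w) (w + 1)}))
    rw [finrank_euclideanSpace_fin] at h2
    have h3 : (pivots lab (lab w) (w + 1)).length = (pivots lab (lab w) w).length + 1 := by
      simp [pivots]
    omega
  · have hmem : ∀ b ∈ pivots lab c w, b < w ∧ Assigned K lab b := fun b hb =>
      assigned_of_mem_pivots hc1 hcK hb
    have hlt : ∀ b ∈ pivots lab c w, b < n := fun b hb => (hmem b hb).1.trans hw
    obtain ⟨r, -, -, hr, hmain⟩ := hp.exists_residual hEs hE0 hD0 hne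
      (h.pivotsNonzero hc1 hcK hw.le) hlt
      (fun b hb e he => h.assigned_clique le_rfl hEs hE0 (hlt b hb) (hlt e he) (hmem b hb).2
        (hmem e he).2) hw (fun b hb => hj b (hmem b hb).1 (hmem b hb).2)
    have hr0 : r = 0 := by
      rw [hz] at hr
      exact norm_eq_zero.1 (pow_eq_zero_iff two_ne_zero |>.1 (by linarith))
    obtain ⟨b, hb⟩ := List.exists_mem_of_ne_nil _ hne
    apply hres
    rw [hmain y hy hwy huy b hb, hr0, inner_zero_left, mul_zero]

/-- Among `K` disjoint sets one avoids all of fewer than `K` elements. -/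
theorem exists_basis_joined (hEs : ∀ i < n, ∀ j < n, E i j → E j i) {v x : ℕ} (hv : v < n)
    (hx : x < n) [DecidableRel E] (hK : #{u ∈ range n | ¬ E v u} < K) :
    ∃ c, 1 ≤ c ∧ c ≤ K ∧ ∀ u ∈ pivots lab c x, E u v := by
  by_contra! hcon
  have : ∀ c : ℕ, ∃ u, c ∈ Icc 1 K → u ∈ pivots lab c x ∧ ¬ E u v := fun c => by
    by_cases hc : c ∈ Icc 1 K
    · obtain ⟨u, hu⟩ := hcon c (mem_Icc.1 hc).1 (mem_Icc.1 hc).2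
      exact ⟨u, fun _ => hu⟩
    · exact ⟨0, fun h => absurd h hc⟩
  choose f hf using this
  -- If every basis missed v somewhere, choosing a missing member in each would be injective, since
  -- the label of an element tells its basis.
  have hcard : #(Icc 1 K) ≤ #{u ∈ range n | ¬ E v u} := by
    refine card_le_card_of_injOn f (fun c hc => ?_) (fun a ha b hb hab => ?_)
    · obtain ⟨h1, h2⟩ := hf c hc
      have h3 := (mem_pivots.1 h1).1
      simp only [coe_filter, mem_range, Set.mem_ofPred_eq]
      exact ⟨by omega, fun h => h2 (hEs v hv _ (by omega) h)⟩
    · rw [← (mem_pivots.1 (hf a ha).1).2, ← (mem_pivots.1 (hf b hb).1).2, hab]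
  rw [Nat.card_Icc] at hcard
  omega

variable {V : Type*} [NormedAddCommGroup V] [InnerProductSpace ℝ V]

/-- An element dependent on all bases can be added to a realization that contains the bases. -/
theorem Labelling.exists_realizes_insert [DecidableRel E] (h : Labelling E D K lab n)
    (hpass : Passed E D n d K lab n)
    (hEs : ∀ i < n, ∀ j < n, E i j → E j i) (hE0 : ∀ i < n, E i i) (hD0 : ∀ i < n, D i i = 0)
    (hDs : ∀ i < n, ∀ j < n, E i j → D i j = D j i)
    (hK : ∀ v < n, #{u ∈ range n | ¬ E v u} < K)
    {S : Set ℕ} (hS : ∀ u ∈ S, u < n) (hA : ∀ u < n, Assigned K lab u → u ∈ S)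
    {x : ℕ} (hx : x < n) (hxS : x ∉ S) (hlab : lab x = K + 1) {p : ℕ → V}
    (hp : Realizes E D S p) : ∃ q : ℕ → V, Realizes E D (insert x S) q := by
  have hj : Joined E K lab x := h.joined x hx (by omega)
  have hmem : ∀ {c}, 1 ≤ c → c ≤ K → ∀ b ∈ pivots lab c x, b < n ∧ Assigned K lab b ∧ E b x ∧
      b ∈ S := fun hc1 hcK b hb => by
    have := assigned_of_mem_pivots hc1 hcK hb
    exact ⟨by omega, this.2, hj b this.1 this.2, hA b (by omega) this.2⟩
  -- The proposal of basis c, built from its members below x. Absence of a conflict supplies the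
  -- vanishing residuals that make its distances correct.
  have hpt : ∀ c, 1 ≤ c → c ≤ K → ∃ z : V,
      (∀ v ∈ S, E x v → (∀ b ∈ pivots lab c x, E b v) → D x v = ‖z - p v‖ ^ 2) ∧
      ∀ z' : V, (∀ b ∈ pivots lab c x, ‖p b - z'‖ ^ 2 = D b x) → z = z' := by
    intro c hc1 hcK
    obtain ⟨hne, hxx⟩ := h.dep x hx hlab c hc1 hcK
    obtain ⟨z, hz1, hz2⟩ := hp.exists_point hD0 hne (h.pivotsNonzero hc1 hcK hx.le)
      (fun b hb => (hmem hc1 hcK b hb).1) (fun b hb => (hmem hc1 hcK b hb).2.2.2)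
      (fun b hb e he => h.assigned_clique le_rfl hEs hE0 (hmem hc1 hcK b hb).1
        (hmem hc1 hcK e he).1 (hmem hc1 hcK b hb).2.1 (hmem hc1 hcK e he).2.1) hx
      (fun b hb => (hDs b (hmem hc1 hcK b hb).1 x hx (hmem hc1 hcK b hb).2.2.1).symm) hxx
    refine ⟨z, fun v hv hxv hbv => hz1 v hv ?_ hbv, hz2⟩
    by_contra hne0
    exact hpass.checked x hx hlab c hc1 hcK ⟨v, hS v hv, hxv, hbv, hne0⟩
  have hK1 : 1 ≤ K := by have := hK x hx; omega
  obtain ⟨z, hz1, hz2⟩ := hpt 1 le_rfl hK1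
  have hdist : ∀ v ∈ S, E x v → D x v = ‖z - p v‖ ^ 2 := by
    intro v hv hxv
    obtain ⟨c, hc1, hcK, hcv⟩ := exists_basis_joined (lab := lab) hEs (hS v hv) hx (hK v (hS v hv))
    obtain ⟨z', hz1', hz2'⟩ := hpt c hc1 hcK
    -- Basis 1 is joined to basis c, so the proposal of c has the right distances to basis 1, and
    -- these determine the point.
    have : z = z' := by
      refine hz2 z' fun b hb => ?_
      obtain ⟨hbn, hba, hbx, hbS⟩ := hmem le_rfl hK1 b hb
      rw [hDs b hbn x hx hbx, norm_sub_rev]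
      exact (hz1' b hbS (hEs b hbn x hx hbx) fun e he => h.assigned_clique le_rfl hEs hE0
        (hmem hc1 hcK e he).1 hbn (hmem hc1 hcK e he).2.1 hba).symm
    rw [this]
    exact hz1' v hv hxv hcv
  have hne : ∀ {v}, v ∈ S → v ≠ x := fun hv h => hxS (h ▸ hv)
  refine ⟨Function.update p x z, ?_⟩
  rintro i (rfl | hi) j (rfl | hj') hij
  · simp [hD0 _ hx]
  · rw [Function.update_self, Function.update_of_ne (hne hj'), hdist j hj' hij]
  · have hji := hEs i (hS i hi) j hx hij
    rw [Function.update_self, Function.update_of_ne (hne hi), norm_sub_rev, ← hdist i hi hji,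
      hDs i (hS i hi) j hx hij]
  · rw [Function.update_of_ne (hne hi), Function.update_of_ne (hne hj'), hp i hi j hj' hij]

/-- Deleted elements are put back one at a time. Conflicts were tested against all y < n, deleted
ones included, so distances to elements already put back are covered as well. -/
theorem Labelling.exists_realizes [DecidableRel E] (h : Labelling E D K lab n)
    (hpass : Passed E D n d K lab n)
    (hEs : ∀ i < n, ∀ j < n, E i j → E j i) (hE0 : ∀ i < n, E i i) (hD0 : ∀ i < n, D i i = 0)
    (hDs : ∀ i < n, ∀ j < n, E i j → D i j = D j i)
    (hK : ∀ v < n, #{u ∈ range n | ¬ E v u} < K) {p : ℕ → V}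
    (hp : Realizes E D {u | u < n ∧ lab u ≤ K} p) :
    ∃ q : ℕ → V, Realizes E D {i | i < n} q := by
  have key : ∀ T : Finset ℕ, (∀ u ∈ T, u < n ∧ lab u = K + 1) →
      ∃ q : ℕ → V, Realizes E D ({u | u < n ∧ lab u ≤ K} ∪ T) q := by
    intro T
    induction T using Finset.induction_on with
    | empty => exact fun _ => ⟨p, by simpa using hp⟩
    | insert x T hxT ih =>
      intro hT
      obtain ⟨q, hq⟩ := ih fun u hu => hT u (mem_insert_of_mem hu)
      obtain ⟨hxn, hxl⟩ := hT x (mem_insert_self x T)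
      rw [coe_insert, Set.union_insert]
      refine h.exists_realizes_insert hpass hEs hE0 hD0 hDs hK ?_ ?_ hxn ?_ hxl hq
      · rintro u (hu | hu)
        · exact hu.1
        · exact (hT u (mem_insert_of_mem hu)).1
      · exact fun u hu hA => Or.inl ⟨hu, hA.2⟩
      · rintro (hu | hu)
        · have := hu.2; omega
        · exact hxT hu
  obtain ⟨q, hq⟩ := key {u ∈ range n | lab u = K + 1} (by simp)
  refine ⟨q, fun i hi j hj => hq i ?_ j ?_⟩ <;> [have := h.le i hi; have := h.le j hj] <;>
    simp only [Set.mem_union, Set.mem_ofPred_eq, coe_filter, mem_range] at * <;> omega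

/-- The kept elements are the basis elements together with the unspecified partners of basis
elements. With a basis elements this gives at most a + a(K - 1) = aK. -/
theorem Labelling.card_le [DecidableRel E] (h : Labelling E D K lab n)
    (hpass : Passed E D n d K lab n) (hK : ∀ v < n, #{u ∈ range n | ¬ E v u} < K) :
    #{u ∈ range n | lab u ≤ K} ≤ (d + 1) * K ^ 2 := by
  set A : Finset ℕ := {u ∈ range n | 1 ≤ lab u ∧ lab u ≤ K} with hA
  -- The largest member of a class found at most d members before it.
  have hclass : ∀ c, 1 ≤ c → c ≤ K → ∀ v ≤ n, (pivots lab c v).length ≤ d + 1 := by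
    intro c hc1 hcK v
    induction v with
    | zero => simp [pivots]
    | succ v ih =>
      intro hv
      unfold pivots
      split_ifs with hl
      · have := hpass.short v hv ⟨by omega, by omega⟩
        rw [hl] at this
        simpa using this
      · exact ih (by omega)
  have hAcard : #A ≤ (d + 1) * K := by
    have hsub : A ⊆ (Icc 1 K).biUnion fun c => {u ∈ range n | lab u = c} := by
      intro u hu
      simp only [hA, mem_filter, mem_range] at hu
      simp only [mem_biUnion, mem_Icc, mem_filter, mem_range]
      exact ⟨lab u, hu.2, hu.1, rfl⟩
    refine (card_le_card hsub).trans ((card_biUnion_le_card_mul _ _ (d + 1) fun c hc => ?_).trans ?_)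
    · rw [← length_pivots]
      exact hclass c (mem_Icc.1 hc).1 (mem_Icc.1 hc).2 n le_rfl
    · rw [Nat.card_Icc, mul_comm]; simp
  have hsub : {u ∈ range n | lab u ≤ K} ⊆ A ∪ A.biUnion fun v => {u ∈ range n | ¬ E v u} := by
    intro u hu
    simp only [mem_filter, mem_range] at hu
    rw [mem_union, mem_biUnion]
    by_cases h0 : lab u = 0
    · obtain ⟨v, hv, hva, hE⟩ := h.other u hu.1 h0
      exact Or.inr ⟨v, mem_filter.2 ⟨mem_range.2 (by omega), hva⟩, by simp [hu.1, hE]⟩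
    · exact Or.inl (mem_filter.2 ⟨mem_range.2 hu.1, by omega, hu.2⟩)
  calc #{u ∈ range n | lab u ≤ K}
      ≤ #A + #A * (K - 1) := by
        refine (card_le_card hsub).trans ((card_union_le _ _).trans (Nat.add_le_add_left ?_ _))
        refine card_biUnion_le_card_mul _ _ _ fun v hv => ?_
        have := hK v (by simp [hA] at hv; exact hv.1)
        omega
    _ ≤ #A * K := by
        -- The truncated K - 1 is harmless: a basis element is an element below n, whose row forces
        -- K ≥ 1.
        rcases Nat.eq_zero_or_pos (#A) with h0 | h0
        · simp [h0]
        · obtain ⟨v, hv⟩ := card_pos.1 h0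
          have := hK v (by simp [hA] at hv; exact hv.1)
          obtain ⟨k, rfl⟩ : ∃ k, K = k + 1 := ⟨K - 1, by omega⟩
          rw [Nat.add_sub_cancel]; exact le_of_eq (by ring)
    _ ≤ (d + 1) * K * K := Nat.mul_le_mul_right _ hAcard
    _ = (d + 1) * K ^ 2 := by ring

end

end EDMC

namespace RealRAM

/-! ### Program logic -/

@[simp] theorem State.setNat_natReg (σ : State) (x v y : ℕ) :
    (σ.setNat x v).natReg y = if y = x then v else σ.natReg y := by
  simp [State.setNat, Function.update_apply]

@[simp] theorem State.setNat_natArr (σ : State) (x v : ℕ) : (σ.setNat x v).natArr = σ.natArr := rfl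

@[simp] theorem State.setNat_realArr (σ : State) (x v : ℕ) :
    (σ.setNat x v).realArr = σ.realArr := rfl

@[simp] theorem State.writeNat_natReg (σ : State) (a k v : ℕ) :
    (σ.writeNat a k v).natReg = σ.natReg := rfl

@[simp] theorem State.writeNat_natArr (σ : State) (a k v b j : ℕ) :
    (σ.writeNat a k v).natArr b j = if b = a ∧ j = k then v else σ.natArr b j := by
  by_cases h : b = a
  · subst h; simp [State.writeNat, Function.update_apply]
  · simp [State.writeNat, h]

@[simp] theorem State.writeReal_realArr (σ : State) (a k : ℕ) (v : ℝ) (b j : ℕ) :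
    (σ.writeReal a k v).realArr b j = if b = a ∧ j = k then v else σ.realArr b j := by
  by_cases h : b = a
  · subst h; simp [State.writeReal, Function.update_apply]
  · simp [State.writeReal, h]

/-- Whether a program has an assignment to the natural-number register `x`. -/
def Prog.modReg (x : ℕ) : Prog → Bool
  | .setNat y _ => x == y
  | .seq P Q => P.modReg x || Q.modReg x
  | .ite _ P Q => P.modReg x || Q.modReg x
  | .while _ P => P.modReg x
  | _ => false

/-- Whether a program writes to the natural-number array `a`. -/
def Prog.modNatArr (a : ℕ) : Prog → Bool
  | .writeNat b _ _ => a == b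
  | .seq P Q => P.modNatArr a || Q.modNatArr a
  | .ite _ P Q => P.modNatArr a || Q.modNatArr a
  | .while _ P => P.modNatArr a
  | _ => false

/-- Whether a program writes to the real array `a`. -/
def Prog.modRealArr (a : ℕ) : Prog → Bool
  | .writeReal b _ _ => a == b
  | .seq P Q => P.modRealArr a || Q.modRealArr a
  | .ite _ P Q => P.modRealArr a || Q.modRealArr a
  | .while _ P => P.modRealArr a
  | _ => false

/-- The states `σ` and `τ` agree on everything that `P` does not assign to. -/
structure Frame (P : Prog) (σ τ : State) : Prop where
  reg : ∀ x, P.modReg x = false → τ.natReg x = σ.natReg x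
  natArr : ∀ a, P.modNatArr a = false → τ.natArr a = σ.natArr a
  realArr : ∀ a, P.modRealArr a = false → τ.realArr a = σ.realArr a

theorem Frame.refl (P : Prog) (σ : State) : Frame P σ σ :=
  ⟨fun _ _ => rfl, fun _ _ => rfl, fun _ _ => rfl⟩

theorem Frame.trans {P : Prog} {σ τ υ : State} (h : Frame P σ τ) (h' : Frame P τ υ) :
    Frame P σ υ :=
  ⟨fun x hx => (h'.reg x hx).trans (h.reg x hx),
    fun x hx => (h'.natArr x hx).trans (h.natArr x hx),
    fun x hx => (h'.realArr x hx).trans (h.realArr x hx)⟩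

theorem Exec.frame {P : Prog} {σ τ : State} {t : ℕ} (h : Exec P σ t τ) : Frame P σ τ := by
  induction h with
  | skip σ => exact Frame.refl _ _
  | setNat σ x e =>
    refine ⟨fun y hy => ?_, fun _ _ => rfl, fun _ _ => rfl⟩
    simp only [Prog.modReg, beq_eq_false_iff_ne] at hy
    simp [hy]
  | setReal σ x u => exact ⟨fun _ _ => rfl, fun _ _ => rfl, fun _ _ => rfl⟩
  | writeNat σ a k e =>
    refine ⟨fun _ _ => rfl, fun b hb => ?_, fun _ _ => rfl⟩
    simp only [Prog.modNatArr, beq_eq_false_iff_ne] at hb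
    funext j
    simp [hb]
  | writeReal σ a k e =>
    refine ⟨fun _ _ => rfl, fun _ _ => rfl, fun b hb => ?_⟩
    simp only [Prog.modRealArr, beq_eq_false_iff_ne] at hb
    funext j
    simp [hb]
  | seq _ _ ih ih' =>
    refine ⟨fun x hx => ?_, fun x hx => ?_, fun x hx => ?_⟩ <;>
      simp only [Prog.modReg, Prog.modNatArr, Prog.modRealArr, Bool.or_eq_false_iff] at hx
    · rw [ih'.reg x hx.2, ih.reg x hx.1]
    · rw [ih'.natArr x hx.2, ih.natArr x hx.1]
    · rw [ih'.realArr x hx.2, ih.realArr x hx.1]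
  | iteTrue _ _ ih =>
    refine ⟨fun x hx => ?_, fun x hx => ?_, fun x hx => ?_⟩ <;>
      simp only [Prog.modReg, Prog.modNatArr, Prog.modRealArr, Bool.or_eq_false_iff] at hx
    · exact ih.reg x hx.1
    · exact ih.natArr x hx.1
    · exact ih.realArr x hx.1
  | iteFalse _ _ ih =>
    refine ⟨fun x hx => ?_, fun x hx => ?_, fun x hx => ?_⟩ <;>
      simp only [Prog.modReg, Prog.modNatArr, Prog.modRealArr, Bool.or_eq_false_iff] at hx
    · exact ih.reg x hx.2
    · exact ih.natArr x hx.2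
    · exact ih.realArr x hx.2
  | whileTrue _ _ _ ih ih' =>
    exact Frame.trans ⟨fun x hx => ih.reg x hx, fun x hx => ih.natArr x hx,
      fun x hx => ih.realArr x hx⟩ ih'
  | whileFalse _ => exact Frame.refl _ _

/-- Started in `σ`, the program `P` halts within `k` time units in a state that satisfies `Q`. -/
def WP (P : Prog) (k : ℕ) (Q : State → Prop) (σ : State) : Prop :=
  ∃ t τ, Exec P σ t τ ∧ t ≤ k ∧ Q τ

theorem WP.mono {P : Prog} {k k' : ℕ} {Q Q' : State → Prop} {σ : State} (h : WP P k Q σ)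
    (hk : k ≤ k') (hQ : ∀ τ, Frame P σ τ → Q τ → Q' τ) : WP P k' Q' σ := by
  obtain ⟨t, τ, h1, h2, h3⟩ := h
  exact ⟨t, τ, h1, h2.trans hk, hQ τ h1.frame h3⟩

theorem WP.skip {k : ℕ} {Q : State → Prop} {σ : State} (hk : 1 ≤ k) (h : Q σ) :
    WP .skip k Q σ := ⟨1, σ, .skip σ, hk, h⟩

theorem WP.setNat {x : ℕ} {e : NExp} {k : ℕ} {Q : State → Prop} {σ : State}
    (hk : e.cost σ + 1 ≤ k) (h : Q (σ.setNat x (e.eval σ))) : WP (.setNat x e) k Q σ :=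
  ⟨_, _, .setNat σ x e, hk, h⟩

theorem WP.writeNat {a : ℕ} {i e : NExp} {k : ℕ} {Q : State → Prop} {σ : State}
    (hk : i.cost σ + e.cost σ + 1 ≤ k) (h : Q (σ.writeNat a (i.eval σ) (e.eval σ))) :
    WP (.writeNat a i e) k Q σ :=
  ⟨_, _, .writeNat σ a i e, hk, h⟩

theorem WP.writeReal {a : ℕ} {i : NExp} {u : RExp} {k : ℕ} {Q : State → Prop} {σ : State}
    (hk : i.cost σ + u.cost σ + 1 ≤ k) (h : Q (σ.writeReal a (i.eval σ) (u.eval σ))) :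
    WP (.writeReal a i u) k Q σ :=
  ⟨_, _, .writeReal σ a i u, hk, h⟩

theorem WP.seq {P P' : Prog} {k k' : ℕ} {Q R : State → Prop} {σ : State} (h : WP P k R σ)
    (h' : ∀ τ, Frame P σ τ → R τ → WP P' k' Q τ) : WP (.seq P P') (k + k') Q σ := by
  obtain ⟨t, τ, h1, h2, h3⟩ := h
  obtain ⟨t', τ', h1', h2', h3'⟩ := h' τ h1.frame h3
  exact ⟨_, _, .seq h1 h1', Nat.add_le_add h2 h2', h3'⟩

theorem WP.ite {b : Test} {P P' : Prog} {k c : ℕ} {Q : State → Prop} {σ : State}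
    (hc : b.cost σ + 1 ≤ c) (h : b.Holds σ → WP P k Q σ) (h' : ¬ b.Holds σ → WP P' k Q σ) :
    WP (.ite b P P') (c + k) Q σ := by
  by_cases hb : b.Holds σ
  · obtain ⟨t, τ, h1, h2, h3⟩ := h hb
    exact ⟨_, _, .iteTrue hb h1, by omega, h3⟩
  · obtain ⟨t, τ, h1, h2, h3⟩ := h' hb
    exact ⟨_, _, .iteFalse hb h1, by omega, h3⟩

/-- Run `body` with register `x` running from `0` to the value of register `lim`, exclusively. -/
def Prog.forLt (x lim : ℕ) (body : Prog) : Prog :=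
  .seq (.setNat x (.const 0)) (.while (.natLe (.add (.reg x) (.const 1)) (.reg lim))
    (.seq body (.setNat x (.add (.reg x) (.const 1)))))

/-- Each round costs 10 besides the body: 6 for the test and the loop, 4 for the increment. The 8
pays for the initialization and the final failing test. The invariant after a step is stated for the
state in which the counter has already been increased. -/
theorem WP.forLt {x lim : ℕ} {body : Prog} {k N : ℕ} {Q : State → Prop} {σ : State}
    (I : ℕ → State → Prop) (hN : σ.natReg lim = N) (hx : body.modReg x = false)
    (hl : (Prog.forLt x lim body).modReg lim = false) (h0 : I 0 (σ.setNat x 0))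
    (hstep : ∀ j < N, ∀ τ, Frame (Prog.forLt x lim body) σ τ → τ.natReg x = j → I j τ →
      WP body k (fun υ => I (j + 1) (υ.setNat x (j + 1))) τ)
    (hpost : ∀ τ, Frame (Prog.forLt x lim body) σ τ → I N τ → Q τ) :
    WP (Prog.forLt x lim body) (N * (k + 10) + 8) Q σ := by
  have hxl : lim ≠ x := by
    simp only [Prog.forLt, Prog.modReg, Bool.or_eq_false_iff, beq_eq_false_iff_ne] at hl
    exact hl.1
  have key : ∀ r j, j + r = N → ∀ τ, Frame (Prog.forLt x lim body) σ τ → τ.natReg x = j → I j τ →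
      ∃ t υ, Exec (.while (.natLe (.add (.reg x) (.const 1)) (.reg lim))
        (.seq body (.setNat x (.add (.reg x) (.const 1))))) τ t υ ∧ t ≤ r * (k + 10) + 6 ∧
        Frame (Prog.forLt x lim body) σ υ ∧ I N υ := by
    intro r
    induction r with
    | zero =>
      intro j hj τ hF hτ hI
      refine ⟨_, τ, .whileFalse ?_, ?_, hF, ?_⟩
      · simp only [Test.Holds, NExp.eval, hτ, hF.reg lim hl, hN]
        omega
      · simp [Test.cost, NExp.cost]
      · have : j = N := by omega
        exact this ▸ hI
    | succ r ih =>
      intro j hj τ hF hτ hI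
      obtain ⟨t, υ, h1, h2, h3⟩ := hstep j (by omega) τ hF hτ hI
      have hυ : υ.natReg x = j := (h1.frame.reg x hx).trans hτ
      have h4 : Exec (.seq body (.setNat x (.add (.reg x) (.const 1)))) τ (t + 4)
          (υ.setNat x (j + 1)) := by
        have := Exec.setNat υ x (.add (.reg x) (.const 1))
        simp only [NExp.eval, NExp.cost, hυ] at this
        exact .seq h1 this
      have hF' : Frame (Prog.forLt x lim body) σ (υ.setNat x (j + 1)) := by
        refine hF.trans ⟨fun y hy => ?_, fun y hy => ?_, fun y hy => ?_⟩
        · refine h4.frame.reg y ?_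
          simp only [Prog.forLt, Prog.modReg, Bool.or_eq_false_iff] at hy ⊢
          exact hy.2
        · refine h4.frame.natArr y ?_
          simpa [Prog.forLt, Prog.modNatArr] using hy
        · refine h4.frame.realArr y ?_
          simpa [Prog.forLt, Prog.modRealArr] using hy
      obtain ⟨t', υ', h1', h2', h3'⟩ := ih (j + 1) (by omega) _ hF' (by simp) h3
      refine ⟨_, υ', .whileTrue ?_ h4 h1', ?_, h3'⟩
      · simp only [Test.Holds, NExp.eval, hτ, hF.reg lim hl, hN]
        omega
      · simp only [Test.cost, NExp.cost]
        rw [Nat.succ_mul]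
        omega
  have hF0 : Frame (Prog.forLt x lim body) σ (σ.setNat x 0) := by
    refine ⟨fun y hy => ?_, fun _ _ => rfl, fun _ _ => rfl⟩
    have : y ≠ x := by
      simp only [Prog.forLt, Prog.modReg, Bool.or_eq_false_iff, beq_eq_false_iff_ne] at hy
      exact hy.1
    simp [this]
  obtain ⟨t, υ, h1, h2, h3, h4⟩ := key N 0 (by omega) _ hF0 (by simp) h0
  refine ⟨_, υ, .seq (.setNat σ x (.const 0)) h1, ?_, hpost υ h3 h4⟩
  simp only [NExp.cost]
  omega

end RealRAM

/-! ### Matrices in row-major order and the input in memory -/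

namespace RealRAM

theorem Frame.forLt {P : Prog} {σ τ : State} (x lim : ℕ) (h : Frame P σ τ) :
    Frame (Prog.forLt x lim P) σ τ := by
  refine ⟨fun y hy => h.reg y ?_, fun y hy => h.natArr y ?_, fun y hy => h.realArr y ?_⟩ <;>
    simp_all [Prog.forLt, Prog.modReg, Prog.modNatArr, Prog.modRealArr]

/-- The index of an entry in row-major order; the arguments are registers. -/
def ix (lim a b : ℕ) : NExp := .add (.mul (.reg a) (.reg lim)) (.reg b)

@[simp] theorem ix_eval (lim a b : ℕ) (σ : State) :
    (ix lim a b).eval σ = σ.natReg a * σ.natReg lim + σ.natReg b := rfl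

theorem size_le_self (k : ℕ) : k.size ≤ k := Nat.size_le.2 Nat.lt_two_pow_self

/-- Bit lengths are bounded crudely by the numbers themselves, which is good enough for a polynomial
bound. -/
theorem ix_cost (lim a b : ℕ) (σ : State) :
    (ix lim a b).cost σ ≤ σ.natReg a + σ.natReg lim + 5 := by
  have h1 := size_le_self (σ.natReg a)
  have h2 := size_le_self (σ.natReg lim)
  simp only [ix, NExp.cost, NExp.eval]
  omega

theorem index_inj {N x y x' y' : ℕ} (hy : y < N) (hy' : y' < N) :
    x * N + y = x' * N + y' ↔ x = x' ∧ y = y' := by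
  constructor
  · intro h
    have h1 : (x * N + y) / N = x := by
      rw [mul_comm, Nat.mul_add_div (by omega), Nat.div_eq_of_lt hy, add_zero]
    have h2 : (x' * N + y') / N = x' := by
      rw [mul_comm, Nat.mul_add_div (by omega), Nat.div_eq_of_lt hy', add_zero]
    have h3 : x = x' := by rw [← h1, ← h2, h]
    subst h3
    exact ⟨rfl, by omega⟩
  · rintro ⟨rfl, rfl⟩; rfl

/-- Fill a real matrix; the row and the column are in the registers `9` and `10`. -/
def fillReal (a lim : ℕ) (u : RExp) : Prog :=
  .forLt 9 lim (.forLt 10 lim (.writeReal a (ix lim 9 10) u))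

/-- Fill a natural-number matrix; the row and the column are in the registers `9` and `10`. -/
def fillNat (a lim : ℕ) (u : NExp) : Prog :=
  .forLt 9 lim (.forLt 10 lim (.writeNat a (ix lim 9 10) u))

/-- A time bound for filling an `N × N` matrix if each entry takes time `C`. -/
def fillCost (N C : ℕ) : ℕ := N * (N * (2 * N + C + 6 + 10) + 8 + 10) + 8

theorem wp_fillReal {a lim : ℕ} {u : RExp} {N C : ℕ} {σ : State} (F : ℕ → ℕ → ℝ)
    (hN : σ.natReg lim = N) (hlim : lim < 9)
    (hu : ∀ x < N, ∀ y < N, ∀ τ, Frame (fillReal a lim u) σ τ → τ.natReg 9 = x →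
      τ.natReg 10 = y → u.eval τ = F x y ∧ u.cost τ ≤ C) :
    WP (fillReal a lim u) (fillCost N C)
      (fun τ => ∀ x < N, ∀ y < N, τ.realArr a (x * N + y) = F x y) σ := by
  have hl9 : lim ≠ 9 := by omega
  have hl10 : lim ≠ 10 := by omega
  refine WP.forLt (fun i τ => ∀ x < i, ∀ y < N, τ.realArr a (x * N + y) = F x y) hN
    (by simp [Prog.forLt, Prog.modReg]) (by simp [Prog.forLt, Prog.modReg, hl9, hl10])
    (by simp) ?_ (fun τ _ h => h)
  intro i hi τ hF hτ hI
  have hτl : τ.natReg lim = N :=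
    (hF.reg lim (by simp [Prog.forLt, Prog.modReg, hl9, hl10])).trans hN
  refine WP.forLt (fun j τ => (∀ x < i, ∀ y < N, τ.realArr a (x * N + y) = F x y) ∧
    ∀ y < j, τ.realArr a (i * N + y) = F i y) hτl rfl
    (by simp [Prog.forLt, Prog.modReg, hl10]) ⟨by simpa using hI, by simp⟩ ?_ ?_
  · intro j hj υ hF' hυ hI'
    have h9 : υ.natReg 9 = i := (hF'.reg 9 rfl).trans hτ
    have hl : υ.natReg lim = N :=
      (hF'.reg lim (by simp [Prog.forLt, Prog.modReg, hl10])).trans hτl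
    obtain ⟨hu1, hu2⟩ := hu i hi j hj υ (hF.trans (hF'.forLt _ _)) h9 hυ
    have hc := ix_cost lim 9 10 υ
    refine WP.writeReal (by omega) ⟨fun x hx y hy => ?_, fun y hy => ?_⟩
    · simp only [State.setNat_realArr, State.writeReal_realArr, ix_eval, hl, h9, hυ, true_and]
      rw [if_neg, hI'.1 x hx y hy]
      rw [index_inj hy hj]; omega
    · simp only [State.setNat_realArr, State.writeReal_realArr, ix_eval, hl, h9, hυ, true_and, hu1]
      rcases Nat.lt_succ_iff_lt_or_eq.1 hy with hy | rfl
      · rw [if_neg (by omega), hI'.2 y hy]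
      · simp
  · intro υ _ h x hx y hy
    rcases Nat.lt_succ_iff_lt_or_eq.1 hx with hx | rfl
    · exact h.1 x hx y hy
    · exact h.2 y hy

theorem wp_fillNat {a lim : ℕ} {u : NExp} {N C : ℕ} {σ : State} (F : ℕ → ℕ → ℕ)
    (hN : σ.natReg lim = N) (hlim : lim < 9)
    (hu : ∀ x < N, ∀ y < N, ∀ τ, Frame (fillNat a lim u) σ τ → τ.natReg 9 = x →
      τ.natReg 10 = y → u.eval τ = F x y ∧ u.cost τ ≤ C) :
    WP (fillNat a lim u) (fillCost N C)
      (fun τ => ∀ x < N, ∀ y < N, τ.natArr a (x * N + y) = F x y) σ := by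
  have hl9 : lim ≠ 9 := by omega
  have hl10 : lim ≠ 10 := by omega
  refine WP.forLt (fun i τ => ∀ x < i, ∀ y < N, τ.natArr a (x * N + y) = F x y) hN
    (by simp [Prog.forLt, Prog.modReg]) (by simp [Prog.forLt, Prog.modReg, hl9, hl10])
    (by simp) ?_ (fun τ _ h => h)
  intro i hi τ hF hτ hI
  have hτl : τ.natReg lim = N :=
    (hF.reg lim (by simp [Prog.forLt, Prog.modReg, hl9, hl10])).trans hN
  refine WP.forLt (fun j τ => (∀ x < i, ∀ y < N, τ.natArr a (x * N + y) = F x y) ∧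
    ∀ y < j, τ.natArr a (i * N + y) = F i y) hτl rfl
    (by simp [Prog.forLt, Prog.modReg, hl10]) ⟨by simpa using hI, by simp⟩ ?_ ?_
  · intro j hj υ hF' hυ hI'
    have h9 : υ.natReg 9 = i := (hF'.reg 9 rfl).trans hτ
    have hl : υ.natReg lim = N :=
      (hF'.reg lim (by simp [Prog.forLt, Prog.modReg, hl10])).trans hτl
    obtain ⟨hu1, hu2⟩ := hu i hi j hj υ (hF.trans (hF'.forLt _ _)) h9 hυ
    have hc := ix_cost lim 9 10 υ
    refine WP.writeNat (by omega) ⟨fun x hx y hy => ?_, fun y hy => ?_⟩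
    · simp only [State.setNat_natArr, State.writeNat_natArr, ix_eval, hl, h9, hυ, true_and]
      rw [if_neg, hI'.1 x hx y hy]
      rw [index_inj hy hj]; omega
    · simp only [State.setNat_natArr, State.writeNat_natArr, ix_eval, hl, h9, hυ, true_and, hu1]
      rcases Nat.lt_succ_iff_lt_or_eq.1 hy with hy | rfl
      · rw [if_neg (by omega), hI'.2 y hy]
      · simp
  · intro υ _ h x hx y hy
    rcases Nat.lt_succ_iff_lt_or_eq.1 hx with hx | rfl
    · exact h.1 x hx y hy
    · exact h.2 y hy

/-- The memory holds an instance of size `n` and dimension `d` with pattern `e` and values `r`. -/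
structure Input (n d : ℕ) (e : ℕ → ℕ) (r : ℕ → ℝ) (σ : State) : Prop where
  size : σ.natReg 0 = n
  dim : σ.natReg 1 = d
  pattern : σ.natArr 0 = e
  values : σ.realArr 0 = r

/-- Whether a program assigns to a part of the memory that holds the input. -/
def Prog.modInput (P : Prog) : Bool :=
  P.modReg 0 || P.modReg 1 || P.modNatArr 0 || P.modRealArr 0

theorem Input.frame {n d : ℕ} {e : ℕ → ℕ} {r : ℕ → ℝ} {σ τ : State} {P : Prog}
    (h : Input n d e r σ) (hF : Frame P σ τ) (hP : P.modInput = false) : Input n d e r τ := by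
  simp only [Prog.modInput, Bool.or_eq_false_iff] at hP
  exact ⟨(hF.reg 0 hP.1.1.1).trans h.size, (hF.reg 1 hP.1.1.2).trans h.dim,
    (hF.natArr 0 hP.1.2).trans h.pattern, (hF.realArr 0 hP.2).trans h.values⟩

end RealRAM

/-! ### Programs for the number of bases and for the join test -/

namespace EDMC

/-- The entry `(i, j)` of the stored pattern is specified. -/
abbrev Spec (n : ℕ) (e : ℕ → ℕ) (i j : ℕ) : Prop := e (i * n + j) ≠ 0

/-- The entry `(i, j)` of the stored values. -/
abbrev Val (n : ℕ) (r : ℕ → ℝ) (i j : ℕ) : ℝ := r (i * n + j)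

open RealRAM Finset

variable {n d : ℕ} {e : ℕ → ℕ} {r : ℕ → ℝ} {σ : State}

/-- Count the unspecified entries of the row in register `9`, plus one. -/
def countRow : Prog :=
  .seq (.setNat 11 (.const 1)) (.forLt 10 0
    (.ite (.natLe (.read 0 (ix 0 9 10)) (.const 0)) (.setNat 11 (.add (.reg 11) (.const 1))) .skip))

theorem wp_countRow {x : ℕ} (hσ : Input n d e r σ) (hx : σ.natReg 9 = x) (hxn : x < n) :
    WP countRow (2 + (n * (2 * n + 9 + 4 + 10) + 8))
      (fun τ => τ.natReg 11 = #{y ∈ range n | ¬ Spec n e x y} + 1) σ := by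
  refine WP.seq (R := fun τ => τ.natReg 11 = 1) (WP.setNat le_rfl rfl) fun τ hF hτ => ?_
  have hin := hσ.frame hF rfl
  refine WP.forLt (fun j τ => τ.natReg 11 = #{y ∈ range j | ¬ Spec n e x y} + 1) hin.size rfl rfl
    (by simpa using hτ) ?_ (fun _ _ h => h)
  intro j hj υ hF' hυ hI
  have hin' := hin.frame hF' rfl
  have h9 : υ.natReg 9 = x := (hF'.reg 9 rfl).trans ((hF.reg 9 rfl).trans hx)
  have hc := ix_cost 0 9 10 υ
  have h0 := hin'.size
  have hread : υ.natArr 0 ((ix 0 9 10).eval υ) = e (x * n + j) := by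
    simp [hin'.pattern, h9, hυ, h0]
  refine WP.ite (c := 2 * n + 9) (k := 4) ?_ (fun hb => WP.setNat le_rfl ?_) (fun hb => WP.skip (by omega) ?_)
  · simp only [Test.cost, NExp.cost]; omega
  · simp only [Test.Holds, NExp.eval, hread] at hb
    simp [NExp.eval, range_add_one, filter_insert, show e (x * n + j) = 0 by omega, hI]
  · simp only [Test.Holds, NExp.eval, hread] at hb
    simp [range_add_one, filter_insert, show e (x * n + j) ≠ 0 by omega, hI]

/-- Put the number of bases into register `5`. -/
def maxRow : Prog :=
  .seq (.setNat 5 (.const 1)) (.forLt 9 0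
    (.seq countRow (.ite (.natLe (.reg 11) (.reg 5)) .skip (.setNat 5 (.reg 11)))))

def maxRowCost (n : ℕ) : ℕ :=
  2 + (n * (2 + (n * (2 * n + 9 + 4 + 10) + 8) + (4 + 2) + 10) + 8)

theorem wp_maxRow (hσ : Input n d e r σ) :
    WP maxRow (maxRowCost n)
      (fun τ => (∀ x < n, #{y ∈ range n | ¬ Spec n e x y} < τ.natReg 5) ∧ 1 ≤ τ.natReg 5 ∧
        ∀ Δ, (∀ x < n, #{y ∈ range n | ¬ Spec n e x y} ≤ Δ) → τ.natReg 5 ≤ Δ + 1) σ := by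
  refine WP.seq (R := fun τ => τ.natReg 5 = 1) (WP.setNat le_rfl rfl) fun τ hF hτ => ?_
  have hin := hσ.frame hF rfl
  refine WP.forLt (fun j τ => (∀ x < j, #{y ∈ range n | ¬ Spec n e x y} < τ.natReg 5) ∧
    1 ≤ τ.natReg 5 ∧ ∀ Δ, (∀ x < n, #{y ∈ range n | ¬ Spec n e x y} ≤ Δ) → τ.natReg 5 ≤ Δ + 1)
    hin.size rfl rfl (by simp [hτ]) ?_ (fun _ _ h => h)
  intro j hj υ hF' hυ hI
  have hin' := hin.frame hF' rfl
  refine WP.seq (wp_countRow hin' hυ hj) fun φ hF'' hφ => ?_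
  rw [← hF''.reg 5 rfl] at hI
  refine WP.ite le_rfl (fun hb => WP.skip (by omega) ?_) (fun hb => WP.setNat le_rfl ?_) <;>
    simp only [Test.Holds, NExp.eval, hφ] at hb <;>
    simp only [State.setNat_natReg, NExp.eval, hφ, if_true, Nat.reduceEqDiff, if_false]
  · refine ⟨fun x hx => ?_, hI.2⟩
    rcases Nat.lt_succ_iff_lt_or_eq.1 hx with hx | rfl
    · exact hI.1 x hx
    · omega
  · refine ⟨fun x hx => ?_, by omega, fun Δ hΔ => by have := hΔ j hj; omega⟩
    rcases Nat.lt_succ_iff_lt_or_eq.1 hx with hx | rfl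
    · have := hI.1 x hx; omega
    · omega

/-- Put `1` into register `11` if all entries between the element in register `6` and the earlier
elements of the bases are specified, and `0` otherwise. -/
def joinTest : Prog :=
  .seq (.setNat 11 (.const 1)) (.forLt 8 6
    (.ite (.and (.and (.natLe (.const 1) (.read 2 (.reg 8))) (.natLe (.read 2 (.reg 8)) (.reg 5)))
        (.natLe (.read 0 (ix 0 8 6)) (.const 0)))
      (.setNat 11 (.const 0)) .skip))

theorem wp_joinTest {v K : ℕ} (hσ : Input n d e r σ) (hv : σ.natReg 6 = v) (hvn : v < n)
    (hK : σ.natReg 5 = K) :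
    WP joinTest (2 + (n * (2 * n + 20 + 2 + 10) + 8))
      (fun τ => τ.natReg 11 = 0 ↔ ¬ Joined (Spec n e) K (σ.natArr 2) v) σ := by
  refine WP.seq (R := fun τ => τ.natReg 11 = 1) (WP.setNat le_rfl rfl) fun τ hF hτ => ?_
  have hin := hσ.frame hF rfl
  refine WP.mono (k := v * (2 * n + 20 + 2 + 10) + 8) (Q := fun τ => τ.natReg 11 = 0 ↔
      ∃ u < v, Assigned K (σ.natArr 2) u ∧ ¬ Spec n e u v) ?_ (by gcongr) ?_
  · refine WP.forLt (fun j τ => τ.natReg 11 = 0 ↔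
      ∃ u < j, Assigned K (σ.natArr 2) u ∧ ¬ Spec n e u v) ((hF.reg 6 rfl).trans hv) rfl rfl
      (by simp [hτ]) ?_ (fun _ _ h => h)
    intro j hj υ hF' hυ hI
    have hin' := hin.frame hF' rfl
    have h6 : υ.natReg 6 = v := (hF'.reg 6 rfl).trans ((hF.reg 6 rfl).trans hv)
    have h5 : υ.natReg 5 = K := (hF'.reg 5 rfl).trans ((hF.reg 5 rfl).trans hK)
    have h2 : υ.natArr 2 = σ.natArr 2 := (hF'.natArr 2 rfl).trans (hF.natArr 2 rfl)
    have h0 := hin'.size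
    have hc := ix_cost 0 8 6 υ
    have hb : (Test.and (.and (.natLe (.const 1) (.read 2 (.reg 8)))
        (.natLe (.read 2 (.reg 8)) (.reg 5))) (.natLe (.read 0 (ix 0 8 6)) (.const 0))).Holds υ ↔
        Assigned K (σ.natArr 2) j ∧ ¬ Spec n e j v := by
      simp [Test.Holds, NExp.eval, h2, h5, h6, hυ, hin'.pattern, h0, Assigned]
    refine WP.ite (c := 2 * n + 20) (k := 2) ?_ (fun hb' => WP.setNat le_rfl ?_)
      (fun hb' => WP.skip (by omega) ?_)
    · simp only [Test.cost, NExp.cost]; omega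
    · rw [hb] at hb'
      simp only [State.setNat_natReg, NExp.eval, if_true, Nat.reduceEqDiff, if_false, true_iff]
      exact ⟨j, Nat.lt_succ_self j, hb'⟩
    · rw [hb] at hb'
      simp only [State.setNat_natReg, Nat.reduceEqDiff, if_false, hI, Nat.lt_succ_iff_lt_or_eq,
        or_and_right, exists_or, exists_eq_left, hb', or_false]
  · intro φ _ hφ
    rw [hφ, Joined]
    push Not
    rfl

/-- The label `c + 1`, where `c` is in register `7`, is the label of the element in register
`8`. -/
def sameLabel : Test :=
  .and (.natLe (.read 2 (.reg 8)) (.add (.reg 7) (.const 1)))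
    (.natLe (.add (.reg 7) (.const 1)) (.read 2 (.reg 8)))

theorem sameLabel_holds {lab : ℕ → ℕ} {c u : ℕ} (h2 : σ.natArr 2 = lab) (h7 : σ.natReg 7 = c)
    (h8 : σ.natReg 8 = u) : sameLabel.Holds σ ↔ lab u = c + 1 := by
  simp only [sameLabel, Test.Holds, NExp.eval, h2, h7, h8]
  omega

theorem sameLabel_cost : sameLabel.cost σ = 13 := rfl

end EDMC

/-! ### Programs for the elimination and for the conflict test -/

namespace EDMC

open RealRAM Finset

variable {n d : ℕ} {e : ℕ → ℕ} {r : ℕ → ℝ} {σ : State}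

/-- The first pivot, the element in register `8`. -/
def initGram : Prog :=
  fillReal 2 0 (.sub (.add (.read 0 (ix 0 9 8)) (.read 0 (ix 0 8 10))) (.read 0 (ix 0 9 10)))

theorem wp_initGram {b : ℕ} (hσ : Input n d e r σ) (hb : σ.natReg 8 = b) (hbn : b < n) :
    WP initGram (fillCost n (6 * n + 20)) (fun τ => ∀ x < n, ∀ y < n,
      τ.realArr 2 (x * n + y) = residual (Val n r) [b] x y) σ := by
  refine wp_fillReal _ hσ.size (by norm_num) fun x hx y hy τ hF h9 h10 => ?_
  have hin := hσ.frame hF rfl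
  have h8 : τ.natReg 8 = b := (hF.reg 8 rfl).trans hb
  have h0 := hin.size
  have c1 := ix_cost 0 9 8 τ
  have c2 := ix_cost 0 8 10 τ
  have c3 := ix_cost 0 9 10 τ
  refine ⟨?_, ?_⟩
  · simp [RExp.eval, residual, hin.values, h0, h8, h9, h10]
  · simp only [RExp.cost]; omega

/-- Pivot on the element in register `8`. -/
def pivotGram : Prog :=
  -- A copy is needed because the pivot row and column are read throughout while array 2 is
  -- overwritten.
  .seq (fillReal 3 0 (.read 2 (ix 0 9 10)))
    (fillReal 2 0 (.sub (.read 3 (ix 0 9 10))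
      (.div (.mul (.read 3 (ix 0 9 8)) (.read 3 (ix 0 8 10))) (.read 3 (ix 0 8 8)))))

theorem wp_pivotGram {b : ℕ} {G : ℕ → ℕ → ℝ} (hσ : Input n d e r σ) (hb : σ.natReg 8 = b)
    (hbn : b < n) (hG : ∀ x < n, ∀ y < n, σ.realArr 2 (x * n + y) = G x y) :
    WP pivotGram (fillCost n (2 * n + 6) + fillCost n (8 * n + 30)) (fun τ => ∀ x < n, ∀ y < n,
      τ.realArr 2 (x * n + y) = G x y - G x b * G b y / G b b) σ := by
  refine WP.seq (R := fun τ => ∀ x < n, ∀ y < n, τ.realArr 3 (x * n + y) = G x y)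
    (wp_fillReal _ hσ.size (by norm_num) fun x hx y hy τ hF h9 h10 => ?_) fun υ hFυ hυ => ?_
  · have hin := hσ.frame hF rfl
    have h0 := hin.size
    have c3 := ix_cost 0 9 10 τ
    refine ⟨?_, ?_⟩
    · simp only [RExp.eval, ix_eval, h0, h9, h10, hF.realArr 2 rfl, hG x hx y hy]
    · simp only [RExp.cost]; omega
  · have hin := hσ.frame hFυ rfl
    refine wp_fillReal _ hin.size (by norm_num) fun x hx y hy τ hF h9 h10 => ?_
    have hin' := hin.frame hF rfl
    have h8 : τ.natReg 8 = b := (hF.reg 8 rfl).trans ((hFυ.reg 8 rfl).trans hb)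
    have h0 := hin'.size
    have c1 := ix_cost 0 9 8 τ
    have c2 := ix_cost 0 8 10 τ
    have c3 := ix_cost 0 9 10 τ
    have c4 := ix_cost 0 8 8 τ
    refine ⟨?_, ?_⟩
    · simp only [RExp.eval, ix_eval, h0, h8, h9, h10, hF.realArr 3 rfl, hυ x hx y hy,
        hυ x hx b hbn, hυ b hbn y hy, hυ b hbn b hbn]
    · simp only [RExp.cost]; omega

/-- Compute the residuals with respect to the earlier elements of the basis in register `7`, and
put their number into register `12`. -/
def gram : Prog :=
  .seq (.setNat 12 (.const 0)) (.forLt 8 6 (.ite sameLabel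
    (.seq (.ite (.natLe (.reg 12) (.const 0)) initGram pivotGram)
      (.setNat 12 (.add (.reg 12) (.const 1)))) .skip))

def gramCost (n : ℕ) : ℕ :=
  2 + (n * (14 + (4 + (fillCost n (6 * n + 20) +
    (fillCost n (2 * n + 6) + fillCost n (8 * n + 30))) + 4) + 10) + 8)

theorem wp_gram {v c : ℕ} (hσ : Input n d e r σ) (hv : σ.natReg 6 = v) (hvn : v < n)
    (hc : σ.natReg 7 = c) {lab : ℕ → ℕ} (hlab : σ.natArr 2 = lab) :
    WP gram (gramCost n) (fun τ => τ.natReg 12 = (pivots lab (c + 1) v).length ∧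
      -- For an empty basis array 2 still holds data from earlier computations, so nothing is
      -- claimed about it.
      (pivots lab (c + 1) v ≠ [] → ∀ x < n, ∀ y < n, τ.realArr 2 (x * n + y) =
        residual (Val n r) (pivots lab (c + 1) v) x y)) σ := by
  refine WP.seq (R := fun τ => τ.natReg 12 = 0) (WP.setNat le_rfl rfl) fun τ hF hτ => ?_
  have hin := hσ.frame hF rfl
  refine WP.mono (k := v * (14 + (4 + (fillCost n (6 * n + 20) +
    (fillCost n (2 * n + 6) + fillCost n (8 * n + 30))) + 4) + 10) + 8)
    (WP.forLt (fun j τ => τ.natReg 12 = (pivots lab (c + 1) j).length ∧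
      (pivots lab (c + 1) j ≠ [] → ∀ x < n, ∀ y < n, τ.realArr 2 (x * n + y) =
        residual (Val n r) (pivots lab (c + 1) j) x y)) ((hF.reg 6 rfl).trans hv) rfl rfl
      (by simp [hτ, pivots]) ?_ (fun _ _ h => h)) (by gcongr) (fun _ _ h => h)
  intro j hj υ hF' hυ hI
  have hin' := hin.frame hF' rfl
  have h7 : υ.natReg 7 = c := (hF'.reg 7 rfl).trans ((hF.reg 7 rfl).trans hc)
  have h2 : υ.natArr 2 = lab := (hF'.natArr 2 rfl).trans ((hF.natArr 2 rfl).trans hlab)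
  have hjn : j < n := by omega
  refine WP.ite (c := 14) (by rw [sameLabel_cost]) (fun hb => ?_)
    (fun hb => WP.skip (by omega) ?_)
  · rw [sameLabel_holds h2 h7 hυ] at hb
    have hp : pivots lab (c + 1) (j + 1) = j :: pivots lab (c + 1) j := by simp [pivots, hb]
    rw [hp]
    refine WP.seq (R := fun τ => ∀ x < n, ∀ y < n, τ.realArr 2 (x * n + y) =
      residual (Val n r) (j :: pivots lab (c + 1) j) x y) (WP.ite le_rfl (fun hb' => ?_)
        (fun hb' => ?_)) fun φ hFφ hφ => WP.setNat le_rfl ?_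
    · simp only [Test.Holds, NExp.eval, hI.1, nonpos_iff_eq_zero, List.length_eq_zero_iff] at hb'
      rw [hb']
      exact (wp_initGram hin' hυ hjn).mono (by omega) fun _ _ h => h
    · simp only [Test.Holds, NExp.eval, hI.1, nonpos_iff_eq_zero, List.length_eq_zero_iff] at hb'
      obtain ⟨a, as, has⟩ := List.exists_cons_of_ne_nil hb'
      have := hI.2 hb'
      rw [has] at this ⊢
      exact (wp_pivotGram hin' hυ hjn this).mono (by omega) fun _ _ h => h
    · simp only [State.setNat_natReg, State.setNat_realArr, NExp.eval, Nat.reduceEqDiff, if_false,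
        if_true, hFφ.reg 12 rfl, hI.1, List.length_cons, true_and]
      exact fun _ => hφ
  · rw [sameLabel_holds h2 h7 hυ] at hb
    have hp : pivots lab (c + 1) (j + 1) = pivots lab (c + 1) j := by simp [pivots, hb]
    rw [hp]
    simpa using hI

/-- The residual of the entry in the given registers vanishes. -/
def residualZero (a b : ℕ) : Test :=
  .and (.realLe (.read 2 (ix 0 a b)) (.cast (.const 0)))
    (.realLe (.cast (.const 0)) (.read 2 (ix 0 a b)))

theorem residualZero_holds {a b x y : ℕ} (h0 : σ.natReg 0 = n) (ha : σ.natReg a = x)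
    (hb : σ.natReg b = y) : (residualZero a b).Holds σ ↔ σ.realArr 2 (x * n + y) = 0 := by
  simp [residualZero, Test.Holds, RExp.eval, NExp.eval, h0, ha, hb, le_antisymm_iff]

theorem residualZero_cost {a b x : ℕ} (h0 : σ.natReg 0 = n) (ha : σ.natReg a = x) (hx : x < n) :
    (residualZero a b).cost σ ≤ 4 * n + 19 := by
  have := ix_cost 0 a b σ
  simp only [residualZero, Test.cost, RExp.cost, NExp.cost]
  omega

/-- Put `1` into register `14` if all entries between the element in register `10` and the
pivots are specified, and `0` otherwise. -/
def pivotsJoinTest : Prog :=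
  .seq (.setNat 14 (.const 1)) (.forLt 8 6
    (.ite (.and sameLabel (.natLe (.read 0 (ix 0 8 10)) (.const 0)))
      (.setNat 14 (.const 0)) .skip))

theorem wp_pivotsJoinTest {v c y : ℕ} (hσ : Input n d e r σ) (hv : σ.natReg 6 = v) (hvn : v < n)
    (hc : σ.natReg 7 = c) (hy : σ.natReg 10 = y) {lab : ℕ → ℕ} (hlab : σ.natArr 2 = lab) :
    WP pivotsJoinTest (2 + (n * (2 * n + 30 + 2 + 10) + 8))
      (fun τ => τ.natReg 14 = 0 ↔ ¬ ∀ u ∈ pivots lab (c + 1) v, Spec n e u y) σ := by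
  refine WP.seq (R := fun τ => τ.natReg 14 = 1) (WP.setNat le_rfl rfl) fun τ hF hτ => ?_
  have hin := hσ.frame hF rfl
  refine WP.mono (k := v * (2 * n + 30 + 2 + 10) + 8) (Q := fun τ => τ.natReg 14 = 0 ↔
      ∃ u < v, lab u = c + 1 ∧ ¬ Spec n e u y) ?_ (by gcongr) ?_
  · refine WP.forLt (fun j τ => τ.natReg 14 = 0 ↔
      ∃ u < j, lab u = c + 1 ∧ ¬ Spec n e u y) ((hF.reg 6 rfl).trans hv) rfl rfl
      (by simp [hτ]) ?_ (fun _ _ h => h)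
    intro j hj υ hF' hυ hI
    have hin' := hin.frame hF' rfl
    have h7 : υ.natReg 7 = c := (hF'.reg 7 rfl).trans ((hF.reg 7 rfl).trans hc)
    have h10 : υ.natReg 10 = y := (hF'.reg 10 rfl).trans ((hF.reg 10 rfl).trans hy)
    have h2 : υ.natArr 2 = lab := (hF'.natArr 2 rfl).trans ((hF.natArr 2 rfl).trans hlab)
    have h0 := hin'.size
    have hcost := ix_cost 0 8 10 υ
    have hb : (Test.and sameLabel (.natLe (.read 0 (ix 0 8 10)) (.const 0))).Holds υ ↔
        lab j = c + 1 ∧ ¬ Spec n e j y := by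
      rw [Test.Holds, sameLabel_holds h2 h7 hυ]
      simp [Test.Holds, NExp.eval, h10, hυ, hin'.pattern, h0]
    refine WP.ite (c := 2 * n + 30) (k := 2) ?_ (fun hb' => WP.setNat le_rfl ?_)
      (fun hb' => WP.skip (by omega) ?_)
    · rw [Test.cost, sameLabel_cost]
      simp only [Test.cost, NExp.cost]
      omega
    · rw [hb] at hb'
      simp only [State.setNat_natReg, NExp.eval, if_true, Nat.reduceEqDiff, if_false, true_iff]
      exact ⟨j, Nat.lt_succ_self j, hb'⟩
    · rw [hb] at hb'
      simp only [State.setNat_natReg, Nat.reduceEqDiff, if_false, hI, Nat.lt_succ_iff_lt_or_eq,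
        or_and_right, exists_or, exists_eq_left, hb', or_false]
  · intro φ _ hφ
    rw [hφ]
    simp only [mem_pivots]
    push Not
    simp only [and_assoc]

/-- Set register `13` if the element in register `6` has an entry that contradicts its dependence
on the basis in register `7`. -/
def conflictTest : Prog :=
  .forLt 10 0 (.ite (.natLe (.const 1) (.read 0 (ix 0 6 10)))
    (.seq pivotsJoinTest
      (.ite (.and (.natLe (.const 1) (.reg 14)) (.not (residualZero 6 10)))
        (.setNat 13 (.const 1)) .skip))
    .skip)

def conflictCost (n : ℕ) : ℕ :=
  n * (2 * n + 10 + (2 + (n * (2 * n + 30 + 2 + 10) + 8) + (4 * n + 30 + 2)) + 10) + 8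

/-- The failure flag is only ever raised, so a failure detected earlier survives; hence the
reference to its initial value. -/
theorem wp_conflictTest {v c : ℕ} (hσ : Input n d e r σ) (hv : σ.natReg 6 = v) (hvn : v < n)
    (hc : σ.natReg 7 = c) {lab : ℕ → ℕ} (hlab : σ.natArr 2 = lab)
    (hG : ∀ y < n, σ.realArr 2 (v * n + y) =
      residual (Val n r) (pivots lab (c + 1) v) v y) :
    WP conflictTest (conflictCost n) (fun τ => τ.natReg 13 = 0 ↔
      σ.natReg 13 = 0 ∧ ¬ Conflict (Spec n e) (Val n r) n lab (c + 1) v) σ := by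
  refine WP.mono (Q := fun τ => τ.natReg 13 = 0 ↔ σ.natReg 13 = 0 ∧ ∀ y < n,
    ¬ (Spec n e v y ∧ (∀ u ∈ pivots lab (c + 1) v, Spec n e u y) ∧
      residual (Val n r) (pivots lab (c + 1) v) v y ≠ 0)) ?_ le_rfl ?_
  · refine WP.forLt (fun j τ => τ.natReg 13 = 0 ↔ σ.natReg 13 = 0 ∧ ∀ y < j,
      ¬ (Spec n e v y ∧ (∀ u ∈ pivots lab (c + 1) v, Spec n e u y) ∧
        residual (Val n r) (pivots lab (c + 1) v) v y ≠ 0)) hσ.size rfl rfl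
      (by simp) ?_ (fun _ _ h => h)
    intro j hj υ hF hυ hI
    have hin := hσ.frame hF rfl
    have h6 : υ.natReg 6 = v := (hF.reg 6 rfl).trans hv
    have h7 : υ.natReg 7 = c := (hF.reg 7 rfl).trans hc
    have h2 : υ.natArr 2 = lab := (hF.natArr 2 rfl).trans hlab
    have h0 := hin.size
    have hcost := ix_cost 0 6 10 υ
    have hb : (Test.natLe (.const 1) (.read 0 (ix 0 6 10))).Holds υ ↔ Spec n e v j := by
      simp [Test.Holds, NExp.eval, h6, hυ, hin.pattern, h0, Nat.one_le_iff_ne_zero]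
    have hsucc : ∀ {φ : State}, (φ.natReg 13 = 0 ↔ υ.natReg 13 = 0 ∧
        ¬ (Spec n e v j ∧ (∀ u ∈ pivots lab (c + 1) v, Spec n e u j) ∧
          residual (Val n r) (pivots lab (c + 1) v) v j ≠ 0)) →
        ((φ.setNat 10 (j + 1)).natReg 13 = 0 ↔ σ.natReg 13 = 0 ∧ ∀ y < j + 1,
          ¬ (Spec n e v y ∧ (∀ u ∈ pivots lab (c + 1) v, Spec n e u y) ∧
            residual (Val n r) (pivots lab (c + 1) v) v y ≠ 0)) := fun {φ} h => by
      rw [State.setNat_natReg, if_neg (by norm_num), h, hI, and_assoc]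
      refine and_congr_right fun _ => ⟨fun h y hy => ?_, fun h =>
        ⟨fun y hy => h y (by omega), h j (by omega)⟩⟩
      rcases Nat.lt_succ_iff_lt_or_eq.1 hy with hy | rfl
      · exact h.1 y hy
      · exact h.2
    refine WP.ite (c := 2 * n + 10)
      (k := 2 + (n * (2 * n + 30 + 2 + 10) + 8) + (4 * n + 30 + 2)) ?_ (fun hb' => ?_)
      (fun hb' => WP.skip (by omega) (hsucc ?_))
    · simp only [Test.cost, NExp.cost]; omega
    · rw [hb] at hb'
      refine WP.seq (wp_pivotsJoinTest hin h6 hvn h7 hυ h2) fun φ hFφ hφ => ?_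
      have h6' : φ.natReg 6 = v := (hFφ.reg 6 rfl).trans h6
      have h10 : φ.natReg 10 = j := (hFφ.reg 10 rfl).trans hυ
      have hin' := hin.frame hFφ rfl
      have hGv : φ.realArr 2 (v * n + j) = residual (Val n r) (pivots lab (c + 1) v) v j := by
        rw [hFφ.realArr 2 rfl, hF.realArr 2 rfl, hG j hj]
      have hb2 : (Test.and (.natLe (.const 1) (.reg 14)) (.not (residualZero 6 10))).Holds φ ↔
          (∀ u ∈ pivots lab (c + 1) v, Spec n e u j) ∧
            residual (Val n r) (pivots lab (c + 1) v) v j ≠ 0 := by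
        rw [Test.Holds, Test.Holds, Test.Holds, residualZero_holds hin'.size h6' h10, hGv]
        simp only [NExp.eval, Nat.one_le_iff_ne_zero, Ne, hφ, not_not]
      have hcost2 := residualZero_cost (b := 10) hin'.size h6' hvn
      refine WP.ite (c := 4 * n + 30) (k := 2) ?_ (fun hb3 => WP.setNat le_rfl (hsucc ?_))
        (fun hb3 => WP.skip (by omega) (hsucc ?_))
      · simp only [Test.cost, NExp.cost]; omega
      · rw [hb2] at hb3
        simp only [State.setNat_natReg, if_true, NExp.eval, one_ne_zero, false_iff, not_and,
          not_not]
        exact fun _ h => hb3.2 (h hb' hb3.1)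
      · rw [hb2] at hb3
        rw [hFφ.reg 13 rfl]
        simp only [hb3, and_false, not_false_iff, and_true]
    · rw [hb] at hb'
      simp only [hb', false_and, not_false_iff, and_true]
  · intro φ _ hφ
    rw [hφ, Conflict]
    simp only [not_exists, not_and]

end EDMC

/-! ### Labelling one element -/

namespace EDMC

open RealRAM Finset

section Congruence

variable {E : ℕ → ℕ → Prop} {D : ℕ → ℕ → ℝ} {n d K v : ℕ} {lab lab' : ℕ → ℕ}

theorem assigned_congr {u : ℕ} (h : lab' u = lab u) : Assigned K lab' u ↔ Assigned K lab u := by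
  rw [Assigned, Assigned, h]

theorem joined_congr {w : ℕ} (h : ∀ u < w, lab' u = lab u) :
    Joined E K lab' w ↔ Joined E K lab w :=
  forall₂_congr fun u hu => by rw [assigned_congr (h u hu)]

theorem conflict_congr {w c : ℕ} (h : ∀ u < w, lab' u = lab u) :
    Conflict E D n lab' c w ↔ Conflict E D n lab c w := by
  rw [Conflict, Conflict, pivots_congr h]

/-- All conditions look only at labels below v, so writing the label of v, or leftover values above
it, cannot disturb them. -/
theorem Labelling.congr (h : Labelling E D K lab v) (hl : ∀ u < v, lab' u = lab u) :
    Labelling E D K lab' v := by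
  have hp : ∀ w < v, ∀ c, pivots lab' c w = pivots lab c w := fun w hw c =>
    pivots_congr fun u hu => hl u (hu.trans hw)
  refine ⟨fun w hw => ?_, fun w hw h0 => ?_, fun w hw h0 => ?_, fun w hw hA => ?_,
    fun w hw h0 c hc1 hcK => ?_⟩
  · rw [hl w hw]; exact h.le w hw
  · rw [hl w hw] at h0
    obtain ⟨u, hu, hA, hE⟩ := h.other w hw h0
    exact ⟨u, hu, (assigned_congr (hl u (hu.trans hw))).2 hA, hE⟩
  · rw [hl w hw] at h0
    exact (joined_congr fun u hu => hl u (hu.trans hw)).2 (h.joined w hw h0)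
  · rw [hl w hw, hp w hw]
    exact h.indep w hw ((assigned_congr (hl w hw)).1 hA)
  · rw [hl w hw] at h0
    rw [hp w hw]
    exact h.dep w hw h0 c hc1 hcK

theorem Passed.congr (h : Passed E D n d K lab v) (hl : ∀ u < v, lab' u = lab u) :
    Passed E D n d K lab' v := by
  refine ⟨fun w hw hA => ?_, fun w hw h0 c hc1 hcK => ?_⟩
  · rw [hl w hw, pivots_congr fun u hu => hl u (hu.trans hw)]
    exact h.short w hw ((assigned_congr (hl w hw)).1 hA)
  · rw [hl w hw] at h0
    rw [conflict_congr fun u hu => hl u (hu.trans hw)]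
    exact h.checked w hw h0 c hc1 hcK

theorem Failed.congr (h : Failed E D n d K lab v) (hl : ∀ u < v, lab' u = lab u) :
    Failed E D n d K lab' v := by
  obtain ⟨w, hw, hj, hor⟩ := h
  have hl' : ∀ u < w, lab' u = lab u := fun u hu => hl u (hu.trans hw)
  refine ⟨w, hw, (joined_congr hl').2 hj, ?_⟩
  simp only [assigned_congr (hl w hw), hl w hw, pivots_congr hl', conflict_congr hl']
  exact hor

theorem Failed.succ (h : Failed E D n d K lab v) : Failed E D n d K lab (v + 1) := by
  obtain ⟨w, hw, h⟩ := h
  exact ⟨w, by omega, h⟩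

theorem Labelling.succ (h : Labelling E D K lab v) (hle : lab v ≤ K + 1)
    (hother : lab v = 0 → ∃ u < v, Assigned K lab u ∧ ¬ E u v)
    (hjoined : lab v ≠ 0 → Joined E K lab v)
    (hindep : Assigned K lab v →
      pivots lab (lab v) v = [] ∨ residual D (pivots lab (lab v) v) v v ≠ 0)
    (hdep : lab v = K + 1 → ∀ c, 1 ≤ c → c ≤ K →
      pivots lab c v ≠ [] ∧ residual D (pivots lab c v) v v = 0) :
    Labelling E D K lab (v + 1) := by
  refine ⟨fun w hw => ?_, fun w hw => ?_, fun w hw => ?_, fun w hw => ?_, fun w hw => ?_⟩ <;>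
    rcases Nat.lt_succ_iff_lt_or_eq.1 hw with hw | rfl
  exacts [h.le w hw, hle, h.other w hw, hother, h.joined w hw, hjoined, h.indep w hw, hindep,
    h.dep w hw, hdep]

theorem Passed.succ (h : Passed E D n d K lab v)
    (hshort : Assigned K lab v → (pivots lab (lab v) v).length ≤ d)
    (hchecked : lab v = K + 1 → ∀ c, 1 ≤ c → c ≤ K → ¬ Conflict E D n lab c v) :
    Passed E D n d K lab (v + 1) := by
  refine ⟨fun w hw => ?_, fun w hw => ?_⟩ <;> rcases Nat.lt_succ_iff_lt_or_eq.1 hw with hw | rfl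
  exacts [h.short w hw, hshort, h.checked w hw, hchecked]

end Congruence

/-- The state of the search for a basis for `v` after `i` bases: whether `v` has been `placed`,
its label `l`, and whether some test has failed. -/
structure Search (E : ℕ → ℕ → Prop) (D : ℕ → ℕ → ℝ) (n d K : ℕ) (lab : ℕ → ℕ) (v fail₀ i : ℕ)
    (placed l fail : ℕ) : Prop where
  dep : placed = 0 → ∀ c, 1 ≤ c → c ≤ i →
    pivots lab c v ≠ [] ∧ residual D (pivots lab c v) v v = 0
  indep : placed ≠ 0 → 1 ≤ l ∧ l ≤ K ∧
    (pivots lab l v = [] ∨ residual D (pivots lab l v) v v ≠ 0)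
  passed : fail = 0 → fail₀ = 0 ∧
    (placed = 0 → ∀ c, 1 ≤ c → c ≤ i → ¬ Conflict E D n lab c v) ∧
    (placed ≠ 0 → (pivots lab l v).length ≤ d)
  failed : fail ≠ 0 → fail₀ ≠ 0 ∨
    (∃ c, 1 ≤ c ∧ c ≤ K ∧ pivots lab c v ≠ [] ∧ residual D (pivots lab c v) v v = 0 ∧
      Conflict E D n lab c v) ∨
    (placed ≠ 0 ∧ d < (pivots lab l v).length)

variable {n d : ℕ} {e : ℕ → ℕ} {r : ℕ → ℝ} {σ : State}

/-- Add the element in register `6` to the basis in register `7`. -/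
def place : Prog :=
  .seq (.writeNat 2 (.reg 6) (.add (.reg 7) (.const 1)))
    (.seq (.setNat 15 (.const 1))
      -- Register 12 holds the size of the basis before the insertion, so failure means at least d +
      -- 2 members afterwards.
      (.ite (.natLe (.add (.reg 1) (.const 1)) (.reg 12)) (.setNat 13 (.const 1)) .skip))

theorem wp_place {v c : ℕ} (hσ : Input n d e r σ) (hv : σ.natReg 6 = v) (hc : σ.natReg 7 = c) :
    WP place (5 + (2 + (6 + 2))) (fun τ => τ.natReg 15 = 1 ∧ τ.natArr 2 v = c + 1 ∧
      (∀ u, u ≠ v → τ.natArr 2 u = σ.natArr 2 u) ∧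
      (τ.natReg 13 = 0 ↔ σ.natReg 13 = 0 ∧ σ.natReg 12 ≤ d)) σ := by
  refine WP.seq (R := fun τ => τ.natArr 2 v = c + 1 ∧ ∀ u, u ≠ v → τ.natArr 2 u = σ.natArr 2 u)
    (WP.writeNat le_rfl ⟨by simp [NExp.eval, hv, hc], fun u hu => by simp [NExp.eval, hv, hu]⟩)
    fun τ hF hτ => ?_
  refine WP.seq (R := fun υ => υ.natReg 15 = 1) (WP.setNat le_rfl rfl) fun υ hF' hυ => ?_
  have h1 : υ.natReg 1 = d := (hF'.reg 1 rfl).trans ((hF.reg 1 rfl).trans hσ.dim)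
  have h12 : υ.natReg 12 = σ.natReg 12 := (hF'.reg 12 rfl).trans (hF.reg 12 rfl)
  have h13 : υ.natReg 13 = σ.natReg 13 := (hF'.reg 13 rfl).trans (hF.reg 13 rfl)
  have h2 : υ.natArr 2 = τ.natArr 2 := hF'.natArr 2 rfl
  refine WP.ite le_rfl (fun hb => WP.setNat le_rfl ?_) (fun hb => WP.skip (by omega) ?_) <;>
    simp only [Test.Holds, NExp.eval, h1, h12] at hb
  · simp only [State.setNat_natReg, State.setNat_natArr, NExp.eval, h2, hυ, Nat.reduceEqDiff,
      if_true, if_false, one_ne_zero, false_iff, true_and, not_and, not_le]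
    exact ⟨hτ.1, hτ.2, fun _ => hb⟩
  · rw [h2, h13]
    exact ⟨hυ, hτ.1, hτ.2, ⟨fun h => ⟨h, by omega⟩, fun h => h.1⟩⟩

/-- Try to add the element in register `6` to the basis in register `7`. -/
def tryBasis : Prog :=
  .ite (.natLe (.reg 15) (.const 0))
    (.seq gram (.ite (.and (.natLe (.const 1) (.reg 12)) (residualZero 6 6)) conflictTest place))
    .skip

def tryCost (n : ℕ) : ℕ := 4 + (gramCost n + (4 * n + 30 + (conflictCost n + 15)))

theorem wp_tryBasis {v i K fail₀ : ℕ} {lab : ℕ → ℕ} (hσ : Input n d e r σ) (hv : σ.natReg 6 = v)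
    (hvn : v < n) (hi : σ.natReg 7 = i) (hiK : i < K) (hlab : ∀ u, u ≠ v → σ.natArr 2 u = lab u)
    (hS : Search (Spec n e) (Val n r) n d K lab v fail₀ i (σ.natReg 15) (σ.natArr 2 v)
      (σ.natReg 13)) :
    WP tryBasis (tryCost n) (fun τ => (∀ u, u ≠ v → τ.natArr 2 u = lab u) ∧
      Search (Spec n e) (Val n r) n d K lab v fail₀ (i + 1) (τ.natReg 15) (τ.natArr 2 v)
        (τ.natReg 13)) σ := by
  have hlab' : ∀ u < v, σ.natArr 2 u = lab u := fun u hu => hlab u hu.ne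
  -- The cell of v is unconstrained before placement and overwritten by it, but the pivots below v
  -- do not depend on it.
  have hpv : ∀ c, pivots (σ.natArr 2) c v = pivots lab c v := fun c => pivots_congr hlab'
  refine WP.ite le_rfl (fun hb => ?_) (fun hb => WP.skip (by omega) ⟨hlab, ?_⟩)
  · have hb0 : σ.natReg 15 = 0 := by simpa [Test.Holds, NExp.eval] using hb
    refine WP.seq (wp_gram hσ hv hvn hi rfl) fun τ hF hτ => ?_
    rw [hpv] at hτ
    have hin := hσ.frame hF rfl
    have h6 : τ.natReg 6 = v := (hF.reg 6 rfl).trans hv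
    have h7 : τ.natReg 7 = i := (hF.reg 7 rfl).trans hi
    have h2 : τ.natArr 2 = σ.natArr 2 := hF.natArr 2 rfl
    have h13 : τ.natReg 13 = σ.natReg 13 := hF.reg 13 rfl
    have h15 : τ.natReg 15 = 0 := (hF.reg 15 rfl).trans hb0
    have hb2 : (Test.and (.natLe (.const 1) (.reg 12)) (residualZero 6 6)).Holds τ ↔
        pivots lab (i + 1) v ≠ [] ∧ residual (Val n r) (pivots lab (i + 1) v) v v = 0 := by
      rw [Test.Holds, Test.Holds, residualZero_holds hin.size h6 h6]
      simp only [NExp.eval, hτ.1, Nat.one_le_iff_ne_zero, Ne, List.length_eq_zero_iff]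
      exact and_congr_right fun h => by rw [hτ.2 h v hvn v hvn]
    have hcost := residualZero_cost (b := 6) hin.size h6 hvn
    refine WP.ite (c := 4 * n + 30) ?_ (fun hb3 => ?_) (fun hb3 => ?_)
    · simp only [Test.cost, NExp.cost]; omega
    · rw [hb2] at hb3
      refine (wp_conflictTest hin h6 hvn h7 h2 ?_).mono (by omega) fun φ hFφ hφ => ?_
      · rw [hpv]; exact fun y hy => hτ.2 hb3.1 v hvn y hy
      rw [conflict_congr hlab', h13] at hφ
      have h15' : φ.natReg 15 = 0 := (hFφ.reg 15 rfl).trans h15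
      rw [hFφ.natArr 2 rfl, h2, h15']
      rw [hb0] at hS
      refine ⟨hlab, fun _ c hc1 hci => ?_, fun h => absurd rfl h, fun h => ?_, fun h => ?_⟩
      · rcases Nat.le_succ_iff.1 hci with hci | rfl
        · exact hS.dep rfl c hc1 hci
        · exact hb3
      · rw [hφ] at h
        obtain ⟨hp1, hp2, -⟩ := hS.passed h.1
        refine ⟨hp1, fun _ c hc1 hci => ?_, fun h => absurd rfl h⟩
        rcases Nat.le_succ_iff.1 hci with hci | rfl
        · exact hp2 rfl c hc1 hci
        · exact h.2
      · by_cases hf : σ.natReg 13 = 0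
        · have hcf : Conflict (Spec n e) (Val n r) n lab (i + 1) v := by
            by_contra hcf
            exact h (hφ.2 ⟨hf, hcf⟩)
          -- A conflict counts even if v is placed in a later basis: `Failed` does not ask for the
          -- label K + 1 here.
          exact Or.inr (Or.inl ⟨i + 1, by omega, hiK, hb3.1, hb3.2, hcf⟩)
        · exact hS.failed hf
    · rw [hb2] at hb3
      refine (wp_place hin h6 h7).mono (by omega) fun φ hFφ hφ => ?_
      obtain ⟨hφ1, hφ2, hφ3, hφ4⟩ := hφ
      rw [h13, hτ.1] at hφ4
      rw [h2] at hφ3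
      rw [hφ1, hφ2]
      refine ⟨fun u hu => (hφ3 u hu).trans (hlab u hu), fun h => absurd h one_ne_zero,
        fun _ => ⟨by omega, hiK, ?_⟩, fun h => ?_, fun h => ?_⟩
      · by_cases hnil : pivots lab (i + 1) v = []
        · exact Or.inl hnil
        · exact Or.inr fun h => hb3 ⟨hnil, h⟩
      · rw [hφ4] at h
        exact ⟨(hS.passed h.1).1, fun h => absurd h one_ne_zero, fun _ => h.2⟩
      · by_cases hf : σ.natReg 13 = 0
        · refine Or.inr (Or.inr ⟨one_ne_zero, ?_⟩)
          by_contra hlen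
          exact h (hφ4.2 ⟨hf, by omega⟩)
        · rcases hS.failed hf with h | h | h
          · exact Or.inl h
          · exact Or.inr (Or.inl h)
          · exact absurd hb0 h.1
  · have hb0 : σ.natReg 15 ≠ 0 := by simpa [Test.Holds, NExp.eval] using hb
    exact ⟨fun h => absurd h hb0, hS.indep, fun h => ⟨(hS.passed h).1, fun h => absurd h hb0,
      (hS.passed h).2.2⟩, hS.failed⟩

/-- Find the label of the element in register `6`. -/
def vertexStep : Prog :=
  .seq joinTest (.ite (.natLe (.const 1) (.reg 11))
    (.seq (.setNat 15 (.const 0)) (.seq (.forLt 7 5 tryBasis)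
      (.ite (.natLe (.reg 15) (.const 0))
        (.writeNat 2 (.reg 6) (.add (.reg 5) (.const 1))) .skip)))
    (.writeNat 2 (.reg 6) (.const 0)))

def vertexCost (n : ℕ) : ℕ :=
  2 + (n * (2 * n + 20 + 2 + 10) + 8) +
    (4 + (2 + ((n + 1) * (tryCost n + 10) + 8 + (4 + 5))))

/-- The invariant of the main loop. -/
structure Invariant (n d : ℕ) (e : ℕ → ℕ) (r : ℕ → ℝ) (K v : ℕ) (σ : State) : Prop where
  labelling : Labelling (Spec n e) (Val n r) K (σ.natArr 2) v
  passed : σ.natReg 13 = 0 → Passed (Spec n e) (Val n r) n d K (σ.natArr 2) v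
  failed : σ.natReg 13 ≠ 0 → Failed (Spec n e) (Val n r) n d K (σ.natArr 2) v

/-- The labelling is maintained even after a failure, because the refutation at the end needs it for
all n elements. -/
theorem wp_vertexStep {v K : ℕ} (hσ : Input n d e r σ) (hv : σ.natReg 6 = v) (hvn : v < n)
    (hK : σ.natReg 5 = K) (hKn : K ≤ n + 1) (hI : Invariant n d e r K v σ) :
    WP vertexStep (vertexCost n) (Invariant n d e r K (v + 1)) σ := by
  refine WP.seq (wp_joinTest hσ hv hvn hK) fun τ hF hτ => ?_
  have hin := hσ.frame hF rfl
  have h5 : τ.natReg 5 = K := (hF.reg 5 rfl).trans hK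
  have h6 : τ.natReg 6 = v := (hF.reg 6 rfl).trans hv
  have h2 : τ.natArr 2 = σ.natArr 2 := hF.natArr 2 rfl
  have h13 : τ.natReg 13 = σ.natReg 13 := hF.reg 13 rfl
  set lab := σ.natArr 2 with hlabdef
  refine WP.ite le_rfl (fun hb => ?_) (fun hb => ?_)
  · have hjoin : Joined (Spec n e) K lab v := by
      by_contra hj
      have := hτ.2 hj
      simp [Test.Holds, NExp.eval, this] at hb
    refine WP.seq (R := fun υ => υ.natReg 15 = 0) (WP.setNat le_rfl rfl) fun υ hF' hυ => ?_
    have hin' := hin.frame hF' rfl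
    have h5' : υ.natReg 5 = K := (hF'.reg 5 rfl).trans h5
    have h6' : υ.natReg 6 = v := (hF'.reg 6 rfl).trans h6
    have h2' : υ.natArr 2 = lab := (hF'.natArr 2 rfl).trans h2
    have h13' : υ.natReg 13 = σ.natReg 13 := (hF'.reg 13 rfl).trans h13
    refine WP.seq (R := fun φ => (∀ u, u ≠ v → φ.natArr 2 u = lab u) ∧
      Search (Spec n e) (Val n r) n d K lab v (σ.natReg 13) K (φ.natReg 15) (φ.natArr 2 v)
        (φ.natReg 13)) ?_ fun φ hFφ hφ => ?_
    · refine WP.mono (k := K * (tryCost n + 10) + 8) (WP.forLt (fun i φ =>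
        (∀ u, u ≠ v → φ.natArr 2 u = lab u) ∧
        Search (Spec n e) (Val n r) n d K lab v (σ.natReg 13) i (φ.natReg 15) (φ.natArr 2 v)
        (φ.natReg 13)) h5' rfl rfl ?_ ?_ (fun _ _ h => h)) (by gcongr) (fun _ _ h => h)
      · simp only [State.setNat_natReg, State.setNat_natArr, Nat.reduceEqDiff, if_false, h2', hυ,
          h13', implies_true, true_and]
        exact ⟨fun _ c hc1 hc0 => by omega, fun h => absurd rfl h,
          fun h => ⟨h, fun _ c hc1 hc0 => by omega, fun h => absurd rfl h⟩, fun h => Or.inl h⟩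
      · intro i hi φ hFφ h7 hφ
        refine (wp_tryBasis (hin'.frame hFφ rfl) ((hFφ.reg 6 rfl).trans h6') hvn h7 hi hφ.1
          hφ.2).mono le_rfl fun ψ _ hψ => ?_
        simpa using hψ
    · have h5φ : φ.natReg 5 = K := (hFφ.reg 5 rfl).trans h5'
      have h6φ : φ.natReg 6 = v := (hFφ.reg 6 rfl).trans h6'
      obtain ⟨hl, hS⟩ := hφ
      refine WP.ite le_rfl (fun hb2 => WP.writeNat le_rfl ?_) (fun hb2 => WP.skip (by omega) ?_)
      · have h15 : φ.natReg 15 = 0 := by simpa [Test.Holds, NExp.eval] using hb2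
        rw [h15] at hS
        simp only [NExp.eval, h5φ, h6φ]
        set ψ := φ.writeNat 2 v (K + 1) with hψ
        have hψv : ψ.natArr 2 v = K + 1 := by simp [hψ]
        have hψl : ∀ u < v, ψ.natArr 2 u = lab u := fun u hu => by simp [hψ, hu.ne, hl u hu.ne]
        have hp : ∀ c, pivots (ψ.natArr 2) c v = pivots lab c v := fun c => pivots_congr hψl
        have hA : ¬ Assigned K (ψ.natArr 2) v := fun h => by
          have := h.2
          omega
        refine ⟨(hI.labelling.congr hψl).succ (by omega) (by omega)
          (fun _ => (joined_congr hψl).2 hjoin) (fun h => absurd h hA) fun _ c hc1 hcK => ?_,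
          fun h => ?_, fun h => ?_⟩
        · rw [hp]; exact hS.dep rfl c hc1 hcK
        · obtain ⟨hp1, hp2, -⟩ := hS.passed h
          refine ((hI.passed hp1).congr hψl).succ (fun h => absurd h hA) fun _ c hc1 hcK => ?_
          rw [conflict_congr hψl]
          exact hp2 rfl c hc1 hcK
        · rcases hS.failed h with h | h | h
          · exact ((hI.failed h).congr hψl).succ
          · refine ⟨v, Nat.lt_succ_self v, (joined_congr hψl).2 hjoin, Or.inr ?_⟩
            simp only [hp, conflict_congr hψl]
            exact h
          · exact absurd rfl h.1
      · have h15 : φ.natReg 15 ≠ 0 := by simpa [Test.Holds, NExp.eval] using hb2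
        have hl' : ∀ u < v, φ.natArr 2 u = lab u := fun u hu => hl u hu.ne
        have hp : ∀ c, pivots (φ.natArr 2) c v = pivots lab c v := fun c => pivots_congr hl'
        obtain ⟨hl1, hlK, hind⟩ := hS.indep h15
        refine ⟨(hI.labelling.congr hl').succ (by omega) (by omega)
          (fun _ => (joined_congr hl').2 hjoin) (fun _ => ?_) (by omega), fun h => ?_, fun h => ?_⟩
        · rw [hp]; exact hind
        · obtain ⟨hp1, -, hp2⟩ := hS.passed h
          refine ((hI.passed hp1).congr hl').succ (fun _ => ?_) (by omega)
          rw [hp]; exact hp2 h15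
        · rcases hS.failed h with h | h | h
          · exact ((hI.failed h).congr hl').succ
          · refine ⟨v, Nat.lt_succ_self v, (joined_congr hl').2 hjoin, Or.inr ?_⟩
            simp only [hp, conflict_congr hl']
            exact h
          · refine ⟨v, Nat.lt_succ_self v, (joined_congr hl').2 hjoin, Or.inl ⟨⟨hl1, hlK⟩, ?_⟩⟩
            rw [hp]; exact h.2
  · have hjoin : ¬ Joined (Spec n e) K lab v := by
      simp only [Test.Holds, NExp.eval, not_le, Nat.lt_one_iff] at hb
      exact hτ.1 hb
    refine WP.writeNat (by simp [NExp.cost]; omega) ?_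
    simp only [NExp.eval, h6]
    set ψ := τ.writeNat 2 v 0 with hψ
    have hψv : ψ.natArr 2 v = 0 := by simp [hψ]
    have hψl : ∀ u < v, ψ.natArr 2 u = lab u := fun u hu => by simp [hψ, hu.ne, h2]
    have hψ13 : ψ.natReg 13 = σ.natReg 13 := by simp [hψ, h13]
    have hA : ¬ Assigned K (ψ.natArr 2) v := fun h => by
      have := h.1
      omega
    refine ⟨(hI.labelling.congr hψl).succ (by omega) (fun _ => ?_) (fun h => absurd hψv h)
      (fun h => absurd h hA) (by omega), fun h => ?_, fun h => ?_⟩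
    · rw [← joined_congr hψl, Joined] at hjoin
      push Not at hjoin
      obtain ⟨u, hu, hA, hE⟩ := hjoin
      exact ⟨u, hu, hA, fun h => h hE⟩
    · exact ((hI.passed (hψ13 ▸ h)).congr hψl).succ (fun h => absurd h hA) (by omega)
    · exact ((hI.failed (hψ13 ▸ h)).congr hψl).succ

end EDMC

/-! ### Writing the output, the whole program and its running time -/

namespace EDMC

open RealRAM Finset

variable {n d : ℕ} {e : ℕ → ℕ} {r : ℕ → ℝ} {σ : State}

/-- List the elements with label at most `K` in the array `3`, and put their number into
register `2`. -/
def collect : Prog :=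
  .seq (.setNat 2 (.const 0)) (.forLt 6 0 (.ite (.natLe (.read 2 (.reg 6)) (.reg 5))
    (.seq (.writeNat 3 (.reg 2) (.reg 6)) (.setNat 2 (.add (.reg 2) (.const 1)))) .skip))

def collectCost (n : ℕ) : ℕ := 2 + (n * (5 + (3 + 4) + 10) + 8)

/-- The first `m` entries of `s` list the elements below `v` with label at most `K` in increasing
order. -/
structure Lists (K : ℕ) (lab : ℕ → ℕ) (v m : ℕ) (s : ℕ → ℕ) : Prop where
  card : m = #{u ∈ range v | lab u ≤ K}
  mem : ∀ k < m, s k < v ∧ lab (s k) ≤ K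
  lt : ∀ l < m, ∀ k < l, s k < s l
  surj : ∀ u < v, lab u ≤ K → ∃ k < m, s k = u

theorem Lists.skip {K v m : ℕ} {lab s : ℕ → ℕ} (h : Lists K lab v m s) (hv : ¬ lab v ≤ K) :
    Lists K lab (v + 1) m s := by
  refine ⟨?_, fun k hk => ⟨(h.mem k hk).1.trans (Nat.lt_succ_self v), (h.mem k hk).2⟩, h.lt,
    fun u hu hl => ?_⟩
  · rw [range_add_one, filter_insert, if_neg hv]; exact h.card
  · rcases Nat.lt_succ_iff_lt_or_eq.1 hu with hu | rfl
    · exact h.surj u hu hl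
    · exact absurd hl hv

theorem Lists.push {K v m : ℕ} {lab s s' : ℕ → ℕ} (h : Lists K lab v m s) (hv : lab v ≤ K)
    (hs : ∀ k < m, s' k = s k) (hm : s' m = v) : Lists K lab (v + 1) (m + 1) s' := by
  refine ⟨?_, fun k hk => ?_, fun l hl k hk => ?_, fun u hu hl => ?_⟩
  · rw [range_add_one, filter_insert, if_pos hv, card_insert_of_notMem (by simp), ← h.card]
  · rcases Nat.lt_succ_iff_lt_or_eq.1 hk with hk | rfl
    · rw [hs k hk]; exact ⟨(h.mem k hk).1.trans (Nat.lt_succ_self v), (h.mem k hk).2⟩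
    · rw [hm]; exact ⟨Nat.lt_succ_self v, hv⟩
  · rcases Nat.lt_succ_iff_lt_or_eq.1 hl with hl | rfl
    · rw [hs k (hk.trans hl), hs l hl]; exact h.lt l hl k hk
    · rw [hs k hk, hm]; exact (h.mem k hk).1
  · rcases Nat.lt_succ_iff_lt_or_eq.1 hu with hu | rfl
    · obtain ⟨k, hk, rfl⟩ := h.surj u hu hl
      exact ⟨k, by omega, hs k hk⟩
    · exact ⟨m, by omega, hm⟩

theorem wp_collect {K : ℕ} {lab : ℕ → ℕ} (hσ : Input n d e r σ) (hK : σ.natReg 5 = K)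
    (hlab : σ.natArr 2 = lab) :
    WP collect (collectCost n) (fun τ => Lists K lab n (τ.natReg 2) (τ.natArr 3)) σ := by
  refine WP.seq (R := fun τ => τ.natReg 2 = 0) (WP.setNat le_rfl rfl) fun τ hF hτ => ?_
  have hin := hσ.frame hF rfl
  refine WP.forLt (fun v τ => Lists K lab v (τ.natReg 2) (τ.natArr 3)) hin.size rfl rfl
    ?_ ?_ (fun _ _ h => h)
  · refine ⟨?_, ?_, ?_, ?_⟩ <;> simp [hτ]
  intro v hv υ hF' hυ hI
  have h5 : υ.natReg 5 = K := (hF'.reg 5 rfl).trans ((hF.reg 5 rfl).trans hK)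
  have h2 : υ.natArr 2 = lab := (hF'.natArr 2 rfl).trans ((hF.natArr 2 rfl).trans hlab)
  refine WP.ite (c := 5) (k := 3 + 4) le_rfl (fun hb => ?_) (fun hb => WP.skip (by omega) ?_) <;>
    simp only [Test.Holds, NExp.eval, h2, h5, hυ] at hb
  · refine WP.seq (R := fun φ => (∀ k < υ.natReg 2, φ.natArr 3 k = υ.natArr 3 k) ∧
      φ.natArr 3 (υ.natReg 2) = v) (WP.writeNat le_rfl ⟨fun k hk => ?_, ?_⟩)
      fun φ hFφ hφ => WP.setNat le_rfl ?_
    · simp [NExp.eval, hk.ne]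
    · simp [NExp.eval, hυ]
    · simp only [NExp.eval, hFφ.reg 2 rfl, State.setNat_natReg, State.setNat_natArr,
        Nat.reduceEqDiff, if_true, if_false]
      exact hI.push hb hφ.1 hφ.2
  · simpa using hI.skip hb

/-- The index of an entry of the submatrix in the input. -/
def subIx : NExp := .add (.mul (.read 3 (.reg 9)) (.reg 0)) (.read 3 (.reg 10))

/-- Write the output instance. -/
def output : Prog :=
  .seq (fillNat 1 2 (.read 0 subIx)) (.seq (fillReal 1 2 (.read 0 subIx))
    (.seq (.setNat 3 (.reg 1)) (.setNat 4 (.const 2))))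

def outputCost (n : ℕ) : ℕ := fillCost n (2 * n + 10) + (fillCost n (2 * n + 10) + (2 + 2))

theorem fillCost_mono {N N' : ℕ} (h : N ≤ N') (C : ℕ) : fillCost N C ≤ fillCost N' C := by
  unfold fillCost; gcongr

theorem wp_output {K m : ℕ} {lab s : ℕ → ℕ} (hσ : Input n d e r σ) (hm : σ.natReg 2 = m)
    (hs : σ.natArr 3 = s) (hL : Lists K lab n m s) :
    WP output (outputCost n) (fun τ => τ.natReg 2 = m ∧ τ.natReg 3 = d ∧ τ.natReg 4 = 2 ∧
      ∀ x < m, ∀ y < m, τ.natArr 1 (x * m + y) = e (s x * n + s y) ∧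
        τ.realArr 1 (x * m + y) = r (s x * n + s y)) σ := by
  have hmn : m ≤ n := by
    rw [hL.card]
    exact (card_filter_le _ _).trans (card_range n).le
  have hsub : ∀ {x y : ℕ} {τ : State}, x < m → y < m → Input n d e r τ → τ.natArr 3 = s →
      τ.natReg 9 = x → τ.natReg 10 = y →
      subIx.eval τ = s x * n + s y ∧ subIx.cost τ + 1 ≤ 2 * n + 10 := by
    intro x y τ hx hy hin h3 h9 h10
    have h0 := hin.size
    have c1 := size_le_self (s x)
    have c2 := size_le_self n
    have := (hL.mem x hx).1
    simp only [subIx, NExp.eval, NExp.cost, h3, h9, h10, h0, true_and]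
    omega
  refine WP.seq (R := fun τ => ∀ x < m, ∀ y < m, τ.natArr 1 (x * m + y) = e (s x * n + s y))
    ((wp_fillNat _ hm (by norm_num) fun x hx y hy τ hF h9 h10 => ?_).mono (fillCost_mono hmn _)
      fun _ _ h => h) fun τ hF hτ => ?_
  · have hin := hσ.frame hF rfl
    obtain ⟨h1, h2⟩ := hsub hx hy hin ((hF.natArr 3 rfl).trans hs) h9 h10
    exact ⟨by rw [NExp.eval, h1, hin.pattern], h2⟩
  have hin := hσ.frame hF rfl
  have hm' : τ.natReg 2 = m := (hF.reg 2 rfl).trans hm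
  have hs' : τ.natArr 3 = s := (hF.natArr 3 rfl).trans hs
  refine WP.seq (R := fun τ => ∀ x < m, ∀ y < m, τ.realArr 1 (x * m + y) = r (s x * n + s y))
    ((wp_fillReal _ hm' (by norm_num) fun x hx y hy υ hF' h9 h10 => ?_).mono
      (fillCost_mono hmn _) fun _ _ h => h) fun υ hF' hυ => ?_
  · have hin' := hin.frame hF' rfl
    obtain ⟨h1, h2⟩ := hsub hx hy hin' ((hF'.natArr 3 rfl).trans hs') h9 h10
    exact ⟨by rw [RExp.eval, h1, hin'.values], h2⟩
  have hin' := hin.frame hF' rfl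
  refine WP.seq (R := fun φ => φ.natReg 3 = d) (WP.setNat le_rfl ?_) fun φ hFφ hφ =>
    WP.setNat le_rfl ?_
  · simp [NExp.eval, hin'.dim]
  · simp only [State.setNat_natReg, State.setNat_natArr, State.setNat_realArr, NExp.eval,
      Nat.reduceEqDiff, if_true, if_false, hFφ.reg 2 rfl, hF'.reg 2 rfl, hm', hφ,
      hFφ.natArr 1 rfl, hF'.natArr 1 rfl, hFφ.realArr 1 rfl, true_and]
    exact fun x hx y hy => ⟨hτ x hx y hy, hυ x hx y hy⟩

/-- The kernelization. -/
def kernelize : Prog :=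
  .seq maxRow (.seq (.setNat 13 (.const 0)) (.seq (.forLt 6 0 vertexStep)
    (.ite (.natLe (.reg 13) (.const 0)) (.seq collect output) (.setNat 4 (.const 0)))))

def kernelizeCost (n : ℕ) : ℕ :=
  maxRowCost n + (2 + (n * (vertexCost n + 10) + 8 + (4 + (collectCost n + outputCost n))))

/-- Only the verdicts 0 and 2 occur. The number K is computed from the matrix, so the bound Δ is not
an input. The dimension is merely incremented, compared and copied, so it does not enter the time
bound. -/
theorem wp_kernelize (hσ : Input n d e r σ) :
    WP kernelize (kernelizeCost n) (fun τ => ∃ (K : ℕ) (lab : ℕ → ℕ), 1 ≤ K ∧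
      (∀ x < n, #{y ∈ range n | ¬ Spec n e x y} < K) ∧
      (∀ Δ, (∀ x < n, #{y ∈ range n | ¬ Spec n e x y} ≤ Δ) → K ≤ Δ + 1) ∧
      Labelling (Spec n e) (Val n r) K lab n ∧
      ((verdict τ = 0 ∧ Failed (Spec n e) (Val n r) n d K lab n) ∨
        (verdict τ = 2 ∧ Passed (Spec n e) (Val n r) n d K lab n ∧
          ∃ (m : ℕ) (s : ℕ → ℕ), Lists K lab n m s ∧ τ.natReg 2 = m ∧ τ.natReg 3 = d ∧
            ∀ x < m, ∀ y < m, τ.natArr 1 (x * m + y) = e (s x * n + s y) ∧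
              τ.realArr 1 (x * m + y) = r (s x * n + s y)))) σ := by
  refine WP.seq (wp_maxRow hσ) fun τ hF hτ => ?_
  obtain ⟨hK1, hK2, hK3⟩ := hτ
  obtain ⟨K, hK⟩ : ∃ K, τ.natReg 5 = K := ⟨_, rfl⟩
  rw [hK] at hK1 hK2 hK3
  -- This bounds the number of rounds over the bases in terms of n alone.
  have hKn : K ≤ n + 1 := hK3 n fun x _ => (card_filter_le _ _).trans (card_range n).le
  refine WP.seq (R := fun υ => υ.natReg 13 = 0) (WP.setNat le_rfl rfl) fun υ hF' hυ => ?_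
  have hin := (hσ.frame hF rfl).frame hF' rfl
  have h5 : υ.natReg 5 = K := (hF'.reg 5 rfl).trans hK
  refine WP.seq (R := Invariant n d e r K n) (WP.forLt (fun v φ => Invariant n d e r K v φ)
    hin.size rfl rfl ?_ ?_ (fun _ _ h => h)) fun φ hFφ hφ => ?_
  -- Nothing is labelled yet, so all conditions are vacuous, whatever the label array contains
  -- initially.
  · refine ⟨⟨?_, ?_, ?_, ?_, ?_⟩, fun _ => ⟨?_, ?_⟩, fun h => absurd ?_ h⟩ <;> simp [hυ]
  · intro v hv φ hFφ h6 hI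
    refine (wp_vertexStep (hin.frame hFφ rfl) h6 hv ((hFφ.reg 5 rfl).trans h5) hKn hI).mono
      le_rfl fun ψ _ hψ => ?_
    exact ⟨hψ.labelling, fun h => hψ.passed (by simpa using h),
      fun h => hψ.failed (by simpa using h)⟩
  · have hinφ := hin.frame hFφ rfl
    refine WP.ite le_rfl (fun hb => ?_) (fun hb => WP.setNat ?_ ?_)
    · have h13 : φ.natReg 13 = 0 := by simpa [Test.Holds, NExp.eval] using hb
      refine WP.seq (wp_collect hinφ ((hFφ.reg 5 rfl).trans h5) rfl) fun ψ hFψ hψ =>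
        (wp_output (hinφ.frame hFψ rfl) rfl rfl hψ).mono le_rfl fun ω _ hω => ?_
      exact ⟨K, _, hK2, hK1, hK3, hφ.labelling,
        Or.inr ⟨hω.2.2.1, hφ.passed h13, _, _, hψ, hω.1, hω.2.1, hω.2.2.2⟩⟩
    · simp only [NExp.cost, collectCost]; omega
    · have h13 : φ.natReg 13 ≠ 0 := by simpa [Test.Holds, NExp.eval] using hb
      exact ⟨K, _, hK2, hK1, hK3, hφ.labelling,
        Or.inl ⟨by simp [verdict, NExp.eval], hφ.failed h13⟩⟩

/-- `f` is given by a polynomial with natural coefficients. -/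
def IsPoly (f : ℕ → ℕ) : Prop := ∃ T : Polynomial ℕ, ∀ n, T.eval n = f n

theorem IsPoly.const (c : ℕ) : IsPoly fun _ => c := ⟨.C c, fun _ => Polynomial.eval_C⟩

theorem IsPoly.id : IsPoly fun n => n := ⟨.X, fun _ => Polynomial.eval_X⟩

theorem IsPoly.add {f g : ℕ → ℕ} (hf : IsPoly f) (hg : IsPoly g) : IsPoly fun n => f n + g n := by
  obtain ⟨S, hS⟩ := hf
  obtain ⟨T, hT⟩ := hg
  exact ⟨S + T, fun n => by rw [Polynomial.eval_add, hS, hT]⟩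

theorem IsPoly.mul {f g : ℕ → ℕ} (hf : IsPoly f) (hg : IsPoly g) : IsPoly fun n => f n * g n := by
  obtain ⟨S, hS⟩ := hf
  obtain ⟨T, hT⟩ := hg
  exact ⟨S * T, fun n => by rw [Polynomial.eval_mul, hS, hT]⟩

theorem isPoly_kernelizeCost : IsPoly kernelizeCost := by
  unfold kernelizeCost maxRowCost vertexCost tryCost gramCost conflictCost collectCost outputCost
    fillCost
  repeat first
    | exact IsPoly.id
    | exact IsPoly.const _
    | apply IsPoly.add
    | apply IsPoly.mul

/-! ### Partial matrices in memory -/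

section Matrices

variable {M : PartialMatrix n}

theorem spec_iff (hσ : σ.Stores 0 M d) (i j : Fin n) :
    Spec n (σ.natArr 0) i j ↔ (M.entry i j).isSome := by
  rw [Spec, (hσ.2.2 i j).1]
  split_ifs with h <;> simp [h]

theorem val_eq (hσ : σ.Stores 0 M d) {i j : Fin n} {v : ℝ} (h : M.entry i j = some v) :
    Val n (σ.realArr 0) i j = v := (hσ.2.2 i j).2 v h

theorem unspecified_eq (hσ : σ.Stores 0 M d) (i : Fin n) :
    M.unspecified i = #{y ∈ range n | ¬ Spec n (σ.natArr 0) i y} := by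
  rw [PartialMatrix.unspecified, ← card_map Fin.valEmbedding]
  congr 1
  ext y
  simp only [mem_map, mem_filter, mem_univ, true_and, Fin.valEmbedding_apply, mem_range]
  constructor
  · rintro ⟨j, hj, rfl⟩
    refine ⟨j.2, ?_⟩
    rw [spec_iff hσ]
    simpa using hj
  · rintro ⟨hy, h⟩
    refine ⟨⟨y, hy⟩, ?_, rfl⟩
    have := (spec_iff hσ i ⟨y, hy⟩).not.1 h
    simpa using this

theorem principal_isYes_iff (hσ : σ.Stores 0 M d) {m : ℕ} (f : Fin m ↪o Fin n) {S : Set ℕ}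
    (hS : ∀ u, u ∈ S ↔ ∃ k, (f k : ℕ) = u) : (M.principal f).IsYes d ↔
      ∃ p : ℕ → EuclideanSpace ℝ (Fin d),
        Realizes (Spec n (σ.natArr 0)) (Val n (σ.realArr 0)) S p := by
  constructor
  · rintro ⟨D, ⟨p, hp⟩, hD⟩
    have hinj : Function.Injective fun k => (f k : ℕ) := fun a b h =>
      f.injective (Fin.ext h)
    -- The value 0 off the selected rows is never used, since realization is required only on S.
    refine ⟨Function.extend (fun k => (f k : ℕ)) p 0, fun i hi j hj hij => ?_⟩
    obtain ⟨k, rfl⟩ := (hS i).1 hi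
    obtain ⟨l, rfl⟩ := (hS j).1 hj
    obtain ⟨v, hv⟩ := Option.isSome_iff_exists.1 ((spec_iff hσ (f k) (f l)).1 hij)
    rw [hinj.extend_apply, hinj.extend_apply, ← hp, val_eq hσ hv]
    exact (hD k l v hv).symm
  · rintro ⟨p, hp⟩
    refine ⟨fun k l => ‖p (f k) - p (f l)‖ ^ 2, ⟨fun k => p (f k), fun _ _ => rfl⟩,
      fun k l v hv => ?_⟩
    have hv' : M.entry (f k) (f l) = some v := hv
    rw [← val_eq hσ hv']
    exact (hp _ ((hS _).2 ⟨k, rfl⟩) _ ((hS _).2 ⟨l, rfl⟩)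
      ((spec_iff hσ _ _).2 (by rw [hv']; rfl))).symm

theorem isYes_iff (hσ : σ.Stores 0 M d) : M.IsYes d ↔ ∃ p : ℕ → EuclideanSpace ℝ (Fin d),
    Realizes (Spec n (σ.natArr 0)) (Val n (σ.realArr 0)) {i | i < n} p :=
  principal_isYes_iff hσ (OrderIso.refl (Fin n)).toOrderEmbedding fun u =>
    ⟨fun h => ⟨⟨u, h⟩, rfl⟩, fun ⟨k, h⟩ => h ▸ k.2⟩

end Matrices

end EDMC

open EDMC in
/-- The input `(M, d)` is read from block `0` of the memory, and an output instance is left in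
block `1`. -/
theorem theorem1p3 :
    ∃ (P : RealRAM.Prog) (T : Polynomial ℕ),
      ∀ (n d Δ : ℕ) (M : PartialMatrix n), (∀ i, M.unspecified i ≤ Δ) →
        ∀ σ : RealRAM.State, σ.Stores 0 M d →
          ∃ (t : ℕ) (τ : RealRAM.State), RealRAM.Exec P σ t τ ∧ t ≤ T.eval n ∧
            ((RealRAM.verdict τ = 0 ∧ ¬ M.IsYes d) ∨
             (RealRAM.verdict τ = 1 ∧ M.IsYes d) ∨
             (RealRAM.verdict τ = 2 ∧
               ∃ (m : ℕ) (f : Fin m ↪o Fin n),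
                 τ.Stores 1 (M.principal f) d ∧
                 ((M.principal f).IsYes d ↔ M.IsYes d) ∧
                 (0 < n → 0 < m) ∧
                 m ≤ (d + 1) * (Δ + 1) ^ 2)) := by
  obtain ⟨T, hT⟩ := isPoly_kernelizeCost
  refine ⟨kernelize, T, fun n d Δ M hΔ σ hσ => ?_⟩
  obtain ⟨t, τ, hexec, ht, K, lab, hK1, hK2, hK3, hlab, hout⟩ :=
    wp_kernelize (σ := σ) ⟨hσ.1, hσ.2.1, rfl, rfl⟩
  refine ⟨t, τ, hexec, by rw [hT]; exact ht, ?_⟩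
  have hEs : ∀ i < n, ∀ j < n, Spec n (σ.natArr 0) i j → Spec n (σ.natArr 0) j i :=
    fun i hi j hj h => (spec_iff hσ ⟨j, hj⟩ ⟨i, hi⟩).2 (by
      rw [M.symm]; exact (spec_iff hσ ⟨i, hi⟩ ⟨j, hj⟩).1 h)
  have hE0 : ∀ i < n, Spec n (σ.natArr 0) i i := fun i hi =>
    (spec_iff hσ ⟨i, hi⟩ ⟨i, hi⟩).2 (by rw [M.diag]; rfl)
  have hD0 : ∀ i < n, Val n (σ.realArr 0) i i = 0 := fun i hi => val_eq hσ (M.diag ⟨i, hi⟩)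
  have hDs : ∀ i < n, ∀ j < n, Spec n (σ.natArr 0) i j →
      Val n (σ.realArr 0) i j = Val n (σ.realArr 0) j i := fun i hi j hj h => by
    obtain ⟨v, hv⟩ := Option.isSome_iff_exists.1 ((spec_iff hσ ⟨i, hi⟩ ⟨j, hj⟩).1 h)
    have hv' : M.entry ⟨j, hj⟩ ⟨i, hi⟩ = some v := by rw [M.symm]; exact hv
    exact (val_eq hσ hv).trans (val_eq hσ hv').symm
  rcases hout with ⟨hv, hfail⟩ | ⟨hv, hpass, m, s, hL, hm, hd, hcopy⟩
  · refine Or.inl ⟨hv, fun hyes => ?_⟩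
    obtain ⟨p, hp⟩ := (isYes_iff hσ).1 hyes
    exact hlab.not_realizes hfail hEs hE0 hD0 p hp
  · refine Or.inr (Or.inr ⟨hv, m, OrderEmbedding.ofStrictMono
      (fun k : Fin m => (⟨s k, (hL.mem k k.2).1⟩ : Fin n)) (fun a b hab => hL.lt b b.2 a hab),
      ⟨hm, hd, fun i j => ?_⟩, ?_, fun hn => ?_, ?_⟩)
    · obtain ⟨h1, h2⟩ := hcopy i i.2 j j.2
      rw [h1, h2]
      exact hσ.2.2 ⟨s i, (hL.mem i i.2).1⟩ ⟨s j, (hL.mem j j.2).1⟩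
    · rw [isYes_iff hσ, principal_isYes_iff hσ (S := {u | u < n ∧ lab u ≤ K})]
      · exact ⟨fun ⟨p, hp⟩ => hlab.exists_realizes hpass hEs hE0 hD0 hDs hK2 hp,
          fun ⟨p, hp⟩ => ⟨p, fun i hi j hj => hp i hi.1 j hj.1⟩⟩
      · exact fun u => ⟨fun h => let ⟨k, hk, hu⟩ := hL.surj u h.1 h.2; ⟨⟨k, hk⟩, hu⟩,
          fun ⟨k, hk⟩ => hk ▸ hL.mem k k.2⟩
    -- The element 0 is never deleted: all bases are empty when it is scanned, and dependence
    -- requires a nonempty basis.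
    · have h0 : lab 0 ≤ K := by
        by_contra h
        exact (hlab.dep 0 hn (by have := hlab.le 0 hn; omega) 1 le_rfl hK1).1 rfl
      obtain ⟨k, hk, -⟩ := hL.surj 0 hn h0
      omega
    · have hKΔ : K ≤ Δ + 1 := hK3 Δ fun x hx => by
        have := hΔ ⟨x, hx⟩
        rwa [unspecified_eq hσ] at this
      rw [hL.card]
      exact (hlab.card_le hpass hK2).trans (by gcongr)
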